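/- Let $V$ be a complex vector space with basis $v_1,\dots,v_n$, and let $\mathbf q=(q_{ij})_{1\le i,j\le n}$ be nonzero complex numbers with $q_{ii}=1$ and $q_{ji}=q_{ij}^{-1}$. Let $S_{\mathbf q}(V)=\mathbb C\langle v_1,\dots,v_n\mid v_iv_j=q_{ij}v_jv_i\rangle$. Let $G$ be a finite group acting linearly on $V$ with ${}^g v_i=\lambda_{g,i}v_i$ for scalars $\lambda_{g,i}$ ($g\in G$, $1\le i\le n$), so that $G$ acts on $S_{\mathbf q}(V)$ by automorphisms. Let $\alpha:G\times G\to\mathbb C^\times$ be a normalized $2$-cocycle, and let $B=S_{\mathbf q}(V)\#_\alpha G$ be the twisted skew group algebra: $B=S_{\mathbf q}(V)\otimes\mathbb CG$ with $(a\,t_g)(b\,t_h)=\alpha(g,h)\,a\,({}^g b)\,t_{gh}$, graded by $\deg v_i=1$ and $\deg t_g=0$. Put $\mathbb C^\alpha G=\mathrm{span}\{t_g\}\subseteq B$, and let $\bigwedge_{\mathbf q^{-1}}(V^*)=\mathbb C\langle v_1^*,\dots,v_n^*\mid v_i^*v_j^*=-q_{ij}^{-1}v_j^*v_i^*\rangle$,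 with product written $\wedge$. A Hochschild $2$-cocycle on $B$ is a bilinear map $\mu:B\times B\to B$ with $a\mu(b,c)+\mu(a,bc)=\mu(ab,c)+\mu(a,b)c$ for all $a,b,c\in B$, and it is called constant if it is homogeneous of degree $-2$, i.e. $\mu(B_i,B_j)\subseteq B_{i+j-2}$ for all $i,j$. Let $\mathrm{HH}^2_{\mathrm{const}}\subseteq \mathrm{HH}^2(B)$ be the subspace of classes represented by constant Hochschild $2$-cocycles. To a constant cocycle $\mu$ associate its quantum skew-symmetrization, viewed as a quantum Koszul $2$-cochain, $$\eta_\mu=\sum_{r<s}\bigl(\mu(v_r,v_s)-q_{rs}\,\mu(v_s,v_r)\bigr)\otimes v_r^*\wedge v_s^*\ \in\ B\otimes\textstyle\bigwedge^2_{\mathbf q^{-1}}(V^*).$$ **Theorem.** The assignment $[\mu]\mapsto\eta_\mu$ is a well-defined linear isomorphism from $\mathrm{HH}^2_{\mathrm{const}}$ onto the space of those $\eta\in\mathbb C^\alpha G\otimes\bigwedge^2_{\mathbf q^{-1}}(V^*)$ that are invariant under $G$ (acting by $b\otimes\omega\mapsto t_g\,b\,t_g^{-1}\otimes{}^g\omega$,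 with ${}^g v_i^*=\lambda_{g,i}^{-1}v_i^*$) and are killed by the quantum Koszul differential $d(b\otimes\omega)=\sum_i\bigl(v_ib\otimes v_i^*\wedge\omega-bv_i\otimes\omega\wedge v_i^*\bigr)$. Let $\mathcal R$ be a set of representatives of the conjugacy classes of $G$ and, for each $a\in\mathcal R$, let $[G/C_G(a)]$ be a set of representatives of the left cosets of the centralizer $C_G(a)$. Under this isomorphism, $\mathrm{HH}^2_{\mathrm{const}}$ has a basis consisting of the classes that correspond to the elements $$\sum_{g\in[G/C_G(a)]}\frac{\alpha(g,a)}{\alpha(gag^{-1},g)}\,\lambda_{g,r}^{-1}\lambda_{g,s}^{-1}\;t_{gag^{-1}}\otimes v_r^*\wedge v_s^*,$$ one for each triple $(a,r,s)$ with $a\in\mathcal R$, $1\le r<s\le n$, $q_{rr'}q_{sr'}=\lambda_{a,r'}$ for all $r'\notin\{r,s\}$, and $\lambda_{h,r}\lambda_{h,s}=\dfrac{\alpha(h,a)}{\alpha(a,h)}$ for all $h\in C_G(a)$. -/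

import Mathlib

open scoped TensorProduct

noncomputable section

/-! ### Algebras with `q`-commutation relations -/

/-- The relations `wᵢ wⱼ = cᵢⱼ wⱼ wᵢ`, for all `i, j`, in the tensor algebra of a space `W` with basis
`w₁, …, wₙ`. -/
inductive QuantumRel {n : ℕ} {W : Type*} [AddCommGroup W] [Module ℂ W]
    (w : Module.Basis (Fin n) ℂ W) (c : Fin n → Fin n → ℂ) :
    TensorAlgebra ℂ W → TensorAlgebra ℂ W → Prop
  | swap (i j : Fin n) : QuantumRel w c
      (TensorAlgebra.ι ℂ (w i) * TensorAlgebra.ι ℂ (w j))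
      (c i j • (TensorAlgebra.ι ℂ (w j) * TensorAlgebra.ι ℂ (w i)))

/-- The algebra `ℂ⟨w₁, …, wₙ ∣ wᵢ wⱼ = cᵢⱼ wⱼ wᵢ for all i, j⟩`. -/
def QuantumAlgebra {n : ℕ} {W : Type*} [AddCommGroup W] [Module ℂ W]
    (w : Module.Basis (Fin n) ℂ W) (c : Fin n → Fin n → ℂ) : Type _ :=
  RingQuot (QuantumRel w c)

namespace QuantumAlgebra

instance {n : ℕ} {W : Type*} [AddCommGroup W] [Module ℂ W]
    (w : Module.Basis (Fin n) ℂ W) (c : Fin n → Fin n → ℂ) : Ring (QuantumAlgebra w c) :=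
  inferInstanceAs (Ring (RingQuot (QuantumRel w c)))

instance {n : ℕ} {W : Type*} [AddCommGroup W] [Module ℂ W]
    (w : Module.Basis (Fin n) ℂ W) (c : Fin n → Fin n → ℂ) : Algebra ℂ (QuantumAlgebra w c) :=
  inferInstanceAs (Algebra ℂ (RingQuot (QuantumRel w c)))

/-- The canonical map from `W` to the algebra. -/
def ι {n : ℕ} {W : Type*} [AddCommGroup W] [Module ℂ W]
    (w : Module.Basis (Fin n) ℂ W) (c : Fin n → Fin n → ℂ) : W →ₗ[ℂ] QuantumAlgebra w c :=
  (RingQuot.mkAlgHom ℂ (QuantumRel w c)).toLinearMap ∘ₗ TensorAlgebra.ι ℂ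

theorem ι_mul_ι {n : ℕ} {W : Type*} [AddCommGroup W] [Module ℂ W]
    (w : Module.Basis (Fin n) ℂ W) (c : Fin n → Fin n → ℂ) (i j : Fin n) :
    ι w c (w i) * ι w c (w j) = c i j • (ι w c (w j) * ι w c (w i)) := by
  have h := RingQuot.mkAlgHom_rel ℂ (QuantumRel.swap (w := w) (c := c) i j)
  rw [map_mul, map_smul, map_mul] at h
  exact h

theorem hom_ext {n : ℕ} {W : Type*} [AddCommGroup W] [Module ℂ W]
    {w : Module.Basis (Fin n) ℂ W} {c : Fin n → Fin n → ℂ} {A : Type*} [Ring A] [Algebra ℂ A]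
    {f f' : QuantumAlgebra w c →ₐ[ℂ] A} (h : ∀ x, f (ι w c x) = f' (ι w c x)) : f = f' := by
  refine RingQuot.ringQuot_ext' ℂ f f' ?_
  refine TensorAlgebra.hom_ext (LinearMap.ext fun x => ?_)
  exact h x

/-- The homogeneous component of degree `d`: the span of all products of `d` elements of `W`. -/
def degreePart {n : ℕ} {W : Type*} [AddCommGroup W] [Module ℂ W]
    (w : Module.Basis (Fin n) ℂ W) (c : Fin n → Fin n → ℂ) (d : ℕ) :
    Submodule ℂ (QuantumAlgebra w c) :=
  LinearMap.range (ι w c) ^ d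

end QuantumAlgebra

/-! ### Diagonal actions -/

/-- The action `ρ` is diagonal in the basis `w`: each `wᵢ` is a common eigenvector. -/
def IsDiagonalAction {n : ℕ} {G W : Type*} [Group G] [AddCommGroup W] [Module ℂ W]
    (w : Module.Basis (Fin n) ℂ W) (ρ : Representation ℂ G W) : Prop :=
  ∀ (g : G) (i : Fin n), ∃ c : ℂ, ρ g (w i) = c • w i

/-- The diagonal matrix coefficients of `ρ`; for a diagonal action, `eigenvalue w ρ g i` is the scalar
`λ_{g,i}` with `ρ g (w i) = λ_{g,i} • w i`. -/
def eigenvalue {n : ℕ} {G W : Type*} [Group G] [AddCommGroup W] [Module ℂ W]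
    (w : Module.Basis (Fin n) ℂ W) (ρ : Representation ℂ G W) (g : G) (i : Fin n) : ℂ :=
  w.repr (ρ g (w i)) i

theorem IsDiagonalAction.apply_eq {n : ℕ} {G W : Type*} [Group G] [AddCommGroup W] [Module ℂ W]
    {w : Module.Basis (Fin n) ℂ W} {ρ : Representation ℂ G W} (h : IsDiagonalAction w ρ)
    (g : G) (i : Fin n) : ρ g (w i) = eigenvalue w ρ g i • w i := by
  obtain ⟨c, hc⟩ := h g i
  simp [eigenvalue, hc]

theorem IsDiagonalAction.dual {n : ℕ} {G W : Type*} [Group G] [AddCommGroup W] [Module ℂ W]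
    {w : Module.Basis (Fin n) ℂ W} {ρ : Representation ℂ G W} (h : IsDiagonalAction w ρ) :
    IsDiagonalAction w.dualBasis ρ.dual := by
  intro g i
  refine ⟨eigenvalue w ρ g⁻¹ i, w.ext fun j => ?_⟩
  have : ρ.dual g (w.dualBasis i) (w j) = w.dualBasis i (ρ g⁻¹ (w j)) := rfl
  rw [this, h.apply_eq]
  by_cases hij : j = i
  · subst hij; simp
  · simp [hij]

/-- The endomorphism of `ℂ⟨w₁, …, wₙ ∣ wᵢ wⱼ = cᵢⱼ wⱼ wᵢ⟩` that extends `ρ g`. -/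
def quantumActionHom {n : ℕ} {G W : Type*} [Group G] [AddCommGroup W] [Module ℂ W]
    {w : Module.Basis (Fin n) ℂ W} {ρ : Representation ℂ G W} (c : Fin n → Fin n → ℂ)
    (h : IsDiagonalAction w ρ) (g : G) : QuantumAlgebra w c →ₐ[ℂ] QuantumAlgebra w c :=
  RingQuot.liftAlgHom ℂ
    ⟨TensorAlgebra.lift ℂ (QuantumAlgebra.ι w c ∘ₗ ρ g), by
      rintro _ _ ⟨i, j⟩
      simp only [map_mul, map_smul, TensorAlgebra.lift_ι_apply, LinearMap.comp_apply, h.apply_eq,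
        smul_mul_smul_comm]
      rw [QuantumAlgebra.ι_mul_ι, smul_comm, mul_comm]⟩

theorem quantumActionHom_ι {n : ℕ} {G W : Type*} [Group G] [AddCommGroup W] [Module ℂ W]
    {w : Module.Basis (Fin n) ℂ W} {ρ : Representation ℂ G W} (c : Fin n → Fin n → ℂ)
    (h : IsDiagonalAction w ρ) (g : G) (x : W) :
    quantumActionHom c h g (QuantumAlgebra.ι w c x) = QuantumAlgebra.ι w c (ρ g x) := by
  refine (RingQuot.liftAlgHom_mkAlgHom_apply ℂ _ _ _).trans ?_
  simp

/-- A diagonal action on `W` extends to an action by algebra endomorphisms (hence, `G` being a group,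
automorphisms) on `ℂ⟨w₁, …, wₙ ∣ wᵢ wⱼ = cᵢⱼ wⱼ wᵢ⟩`. -/
def quantumAction {n : ℕ} {G W : Type*} [Group G] [AddCommGroup W] [Module ℂ W]
    {w : Module.Basis (Fin n) ℂ W} {ρ : Representation ℂ G W} (c : Fin n → Fin n → ℂ)
    (h : IsDiagonalAction w ρ) : G →* (QuantumAlgebra w c →ₐ[ℂ] QuantumAlgebra w c) where
  toFun := quantumActionHom c h
  map_one' := QuantumAlgebra.hom_ext fun x => by
    rw [quantumActionHom_ι, map_one]
    rfl
  map_mul' g g' := QuantumAlgebra.hom_ext fun x => by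
    rw [AlgHom.mul_apply, quantumActionHom_ι, quantumActionHom_ι, quantumActionHom_ι, map_mul]
    rfl

/-! ### Twisted skew group algebras -/

/-- A normalized `2`-cocycle `α : G × G → ℂˣ` (trivial action on the coefficients). -/
structure NormalizedTwoCocycle (G : Type*) [Group G] where
  toFun : G → G → ℂˣ
  cocycle : ∀ g₁ g₂ g₃, toFun g₁ g₂ * toFun (g₁ * g₂) g₃ = toFun g₂ g₃ * toFun g₁ (g₂ * g₃)
  right_one : ∀ g, toFun g 1 = 1
  one_left : ∀ g, toFun 1 g = 1

instance {G : Type*} [Group G] : CoeFun (NormalizedTwoCocycle G) (fun _ => G → G → ℂˣ) :=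
  ⟨NormalizedTwoCocycle.toFun⟩

/-- The twisted skew group algebra `A #_α G`, where `G` acts on `A` by automorphisms through `φ`. Its
underlying space is `A ⊗ ℂG`, i.e. the finitely supported functions `G → A`. -/
def TwistedSkewGroupAlgebra {G A : Type*} [Group G] [Ring A] [Algebra ℂ A]
    (_φ : G →* (A →ₐ[ℂ] A)) (_α : NormalizedTwoCocycle G) : Type _ :=
  G →₀ A

namespace TwistedSkewGroupAlgebra

instance {G A : Type*} [Group G] [Ring A] [Algebra ℂ A]
    (φ : G →* (A →ₐ[ℂ] A)) (α : NormalizedTwoCocycle G) :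
    AddCommGroup (TwistedSkewGroupAlgebra φ α) :=
  inferInstanceAs (AddCommGroup (G →₀ A))

instance {G A : Type*} [Group G] [Ring A] [Algebra ℂ A]
    (φ : G →* (A →ₐ[ℂ] A)) (α : NormalizedTwoCocycle G) :
    Module ℂ (TwistedSkewGroupAlgebra φ α) :=
  inferInstanceAs (Module ℂ (G →₀ A))

/-- `of φ α g a` is the element `a t_g = a ⊗ g`. -/
def of {G A : Type*} [Group G] [Ring A] [Algebra ℂ A]
    (φ : G →* (A →ₐ[ℂ] A)) (α : NormalizedTwoCocycle G) (g : G) :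
    A →ₗ[ℂ] TwistedSkewGroupAlgebra φ α :=
  Finsupp.lsingle g

/-- The coefficient in `A` of `t_g`. -/
def coeff {G A : Type*} [Group G] [Ring A] [Algebra ℂ A]
    (φ : G →* (A →ₐ[ℂ] A)) (α : NormalizedTwoCocycle G) (g : G) :
    TwistedSkewGroupAlgebra φ α →ₗ[ℂ] A :=
  Finsupp.lapply g

/-- The bilinear multiplication determined by `(a t_g) (b t_h) = α(g,h) a (ᵍb) t_{gh}`. -/
def mulBilin {G A : Type*} [Group G] [Ring A] [Algebra ℂ A]
    (φ : G →* (A →ₐ[ℂ] A)) (α : NormalizedTwoCocycle G) :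
    TwistedSkewGroupAlgebra φ α →ₗ[ℂ] TwistedSkewGroupAlgebra φ α →ₗ[ℂ]
      TwistedSkewGroupAlgebra φ α :=
  Finsupp.lsum ℂ fun g => LinearMap.flip <| Finsupp.lsum ℂ fun h => LinearMap.flip <|
    ((α g h : ℂ) • (LinearMap.mul ℂ A).compl₂ (φ g).toLinearMap).compr₂ (of φ α (g * h))

theorem mulBilin_of_of {G A : Type*} [Group G] [Ring A] [Algebra ℂ A]
    (φ : G →* (A →ₐ[ℂ] A)) (α : NormalizedTwoCocycle G) (g h : G) (a b : A) :
    mulBilin φ α (of φ α g a) (of φ α h b) = of φ α (g * h) ((α g h : ℂ) • (a * φ g b)) := by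
  simp only [mulBilin, of]
  erw [Finsupp.lsum_single, LinearMap.flip_apply, Finsupp.lsum_single]
  rfl

theorem hom_ext {G A : Type*} [Group G] [Ring A] [Algebra ℂ A]
    {φ : G →* (A →ₐ[ℂ] A)} {α : NormalizedTwoCocycle G} {M : Type*} [AddCommGroup M] [Module ℂ M]
    {f f' : TwistedSkewGroupAlgebra φ α →ₗ[ℂ] M}
    (h : ∀ g a, f (of φ α g a) = f' (of φ α g a)) : f = f' :=
  Finsupp.lhom_ext h

instance {G A : Type*} [Group G] [Ring A] [Algebra ℂ A]
    (φ : G →* (A →ₐ[ℂ] A)) (α : NormalizedTwoCocycle G) :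
    Mul (TwistedSkewGroupAlgebra φ α) :=
  ⟨fun x y => mulBilin φ α x y⟩

instance {G A : Type*} [Group G] [Ring A] [Algebra ℂ A]
    (φ : G →* (A →ₐ[ℂ] A)) (α : NormalizedTwoCocycle G) :
    One (TwistedSkewGroupAlgebra φ α) :=
  ⟨of φ α 1 1⟩

theorem of_mul_of {G A : Type*} [Group G] [Ring A] [Algebra ℂ A]
    (φ : G →* (A →ₐ[ℂ] A)) (α : NormalizedTwoCocycle G) (g h : G) (a b : A) :
    of φ α g a * of φ α h b = of φ α (g * h) ((α g h : ℂ) • (a * φ g b)) :=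
  mulBilin_of_of φ α g h a b

instance {G A : Type*} [Group G] [Ring A] [Algebra ℂ A]
    (φ : G →* (A →ₐ[ℂ] A)) (α : NormalizedTwoCocycle G) :
    Ring (TwistedSkewGroupAlgebra φ α) :=
  { (inferInstance : AddCommGroup (TwistedSkewGroupAlgebra φ α)) with
    mul := (· * ·)
    one := 1
    left_distrib := fun x y z => map_add (mulBilin φ α x) y z
    right_distrib := fun x y z => LinearMap.map_add₂ (mulBilin φ α) x y z
    zero_mul := fun x => LinearMap.map_zero₂ (mulBilin φ α) x
    mul_zero := fun x => map_zero (mulBilin φ α x)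
    one_mul := fun x => by
      have : mulBilin φ α (of φ α 1 1) = LinearMap.id := hom_ext fun g a => by
        rw [mulBilin_of_of, α.one_left, map_one]; simp
      exact LinearMap.congr_fun this x
    mul_one := fun x => by
      have : (mulBilin φ α).flip (of φ α 1 1) = LinearMap.id := hom_ext fun g a => by
        rw [LinearMap.flip_apply, mulBilin_of_of, α.right_one]; simp
      exact LinearMap.congr_fun this x
    mul_assoc := fun x y z => by
      have h1 : ∀ g a h b, mulBilin φ α (mulBilin φ α (of φ α g a) (of φ α h b)) =
          mulBilin φ α (of φ α g a) ∘ₗ mulBilin φ α (of φ α h b) := fun g a h b =>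
        hom_ext fun k c => by
          simp only [LinearMap.comp_apply, mulBilin_of_of, map_smul, map_mul, LinearMap.smul_apply,
            smul_smul, mul_assoc, AlgHom.mul_apply]
          have h0 := congrArg (Units.val) (α.cocycle g h k)
          push_cast at h0
          rw [h0, mul_comm]
      have h2 : ∀ g a, ((mulBilin φ α).flip z).comp (mulBilin φ α (of φ α g a)) =
          (mulBilin φ α (of φ α g a)).comp ((mulBilin φ α).flip z) := fun g a =>
        hom_ext fun h b => LinearMap.congr_fun (h1 g a h b) z
      have h3 : ((mulBilin φ α).flip z).comp ((mulBilin φ α).flip y) =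
          (mulBilin φ α).flip (mulBilin φ α y z) := hom_ext fun g a =>
        LinearMap.congr_fun (h2 g a) y
      exact LinearMap.congr_fun h3 x }

theorem mul_def {G A : Type*} [Group G] [Ring A] [Algebra ℂ A]
    (φ : G →* (A →ₐ[ℂ] A)) (α : NormalizedTwoCocycle G) (x y : TwistedSkewGroupAlgebra φ α) :
    x * y = mulBilin φ α x y := rfl

instance {G A : Type*} [Group G] [Ring A] [Algebra ℂ A]
    (φ : G →* (A →ₐ[ℂ] A)) (α : NormalizedTwoCocycle G) :
    Algebra ℂ (TwistedSkewGroupAlgebra φ α) :=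
  Algebra.ofModule (fun r x y => LinearMap.map_smul₂ (mulBilin φ α) r x y)
    (fun r x y => map_smul (mulBilin φ α x) r y)

/-- The basis element `t_g` of the twisted group algebra `ℂ^α G ⊆ A #_α G`. -/
def t {G A : Type*} [Group G] [Ring A] [Algebra ℂ A]
    (φ : G →* (A →ₐ[ℂ] A)) (α : NormalizedTwoCocycle G) (g : G) :
    TwistedSkewGroupAlgebra φ α :=
  of φ α g 1

/-- The inverse `(t_g)⁻¹ = α(g, g⁻¹)⁻¹ t_{g⁻¹}`. -/
def tInv {G A : Type*} [Group G] [Ring A] [Algebra ℂ A]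
    (φ : G →* (A →ₐ[ℂ] A)) (α : NormalizedTwoCocycle G) (g : G) :
    TwistedSkewGroupAlgebra φ α :=
  ((α g g⁻¹ : ℂ))⁻¹ • t φ α g⁻¹

theorem t_mul_tInv {G A : Type*} [Group G] [Ring A] [Algebra ℂ A]
    (φ : G →* (A →ₐ[ℂ] A)) (α : NormalizedTwoCocycle G) (g : G) :
    t φ α g * tInv φ α g = 1 := by
  rw [tInv, mul_smul_comm, t, t, of_mul_of, mul_inv_cancel, map_one, mul_one, map_smul, smul_smul,
    inv_mul_cancel₀ (Units.ne_zero _), one_smul]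
  rfl

/-- Conjugation `x ↦ t_g x (t_g)⁻¹`. -/
def conj {G A : Type*} [Group G] [Ring A] [Algebra ℂ A]
    (φ : G →* (A →ₐ[ℂ] A)) (α : NormalizedTwoCocycle G) (g : G) :
    TwistedSkewGroupAlgebra φ α →ₗ[ℂ] TwistedSkewGroupAlgebra φ α :=
  LinearMap.mulRight ℂ (tInv φ α g) ∘ₗ LinearMap.mulLeft ℂ (t φ α g)

end TwistedSkewGroupAlgebra

/-! ### Hochschild cohomology in degree two -/

/-- Hochschild `2`-cochains of `B` with coefficients in `B`, i.e. bilinear maps `B × B → B`. -/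
def TwoCochain (B : Type*) [AddCommGroup B] [Module ℂ B] : Type _ :=
  B →ₗ[ℂ] B →ₗ[ℂ] B

instance (B : Type*) [AddCommGroup B] [Module ℂ B] : AddCommGroup (TwoCochain B) :=
  inferInstanceAs (AddCommGroup (B →ₗ[ℂ] B →ₗ[ℂ] B))

instance (B : Type*) [AddCommGroup B] [Module ℂ B] : Module ℂ (TwoCochain B) :=
  inferInstanceAs (Module ℂ (B →ₗ[ℂ] B →ₗ[ℂ] B))

/-- The value `μ(a, b)`. -/
def TwoCochain.eval {B : Type*} [AddCommGroup B] [Module ℂ B] (μ : TwoCochain B) (a b : B) : B :=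
  (show B →ₗ[ℂ] B →ₗ[ℂ] B from μ) a b

instance (B : Type*) [AddCommGroup B] [Module ℂ B] :
    CoeFun (TwoCochain B) (fun _ => B → B → B) :=
  ⟨TwoCochain.eval⟩

theorem TwoCochain.zero_eval {B : Type*} [AddCommGroup B] [Module ℂ B] (a b : B) :
    (0 : TwoCochain B) a b = 0 := rfl

theorem TwoCochain.add_eval {B : Type*} [AddCommGroup B] [Module ℂ B] (μ ν : TwoCochain B)
    (a b : B) : (μ + ν) a b = μ a b + ν a b := rfl

theorem TwoCochain.smul_eval {B : Type*} [AddCommGroup B] [Module ℂ B] (r : ℂ) (μ : TwoCochain B)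
    (a b : B) : (r • μ) a b = r • μ a b := rfl

/-- Hochschild `2`-cocycles of `B` with coefficients in `B`. -/
def hochschildCocycles (B : Type*) [Ring B] [Algebra ℂ B] : Submodule ℂ (TwoCochain B) where
  carrier := {μ | ∀ a b c, a * μ b c + μ a (b * c) = μ (a * b) c + μ a b * c}
  zero_mem' := by simp [TwoCochain.zero_eval]
  add_mem' := by
    intro μ ν hμ hν a b c
    have h1 := hμ a b c
    have h2 := hν a b c
    simp only [TwoCochain.add_eval, mul_add, add_mul]
    rw [add_add_add_comm, h1, h2, add_add_add_comm]
  smul_mem' := by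
    intro r μ hμ a b c
    have h1 := hμ a b c
    simp only [TwoCochain.smul_eval, mul_smul_comm, smul_mul_assoc, ← smul_add]
    rw [h1]

/-- The Hochschild differential `(δf)(a, b) = a f(b) - f(ab) + f(a) b` on `1`-cochains. -/
def hochschildDelta (B : Type*) [Ring B] [Algebra ℂ B] : (B →ₗ[ℂ] B) →ₗ[ℂ] TwoCochain B where
  toFun f := (LinearMap.mul ℂ B).compl₂ f - (LinearMap.mul ℂ B).compr₂ f + LinearMap.mul ℂ B ∘ₗ f
  map_add' f f' := by
    refine LinearMap.ext fun a => LinearMap.ext fun b => ?_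
    change a * (f b + f' b) - (f (a * b) + f' (a * b)) + (f a + f' a) * b =
      (a * f b - f (a * b) + f a * b) + (a * f' b - f' (a * b) + f' a * b)
    rw [mul_add, add_mul]
    abel
  map_smul' r f := by
    refine LinearMap.ext fun a => LinearMap.ext fun b => ?_
    change a * (r • f b) - r • f (a * b) + (r • f a) * b =
      r • (a * f b - f (a * b) + f a * b)
    rw [mul_smul_comm, smul_mul_assoc, smul_add, smul_sub]

theorem hochschildDelta_apply (B : Type*) [Ring B] [Algebra ℂ B] (f : B →ₗ[ℂ] B) (a b : B) :
    hochschildDelta B f a b = a * f b - f (a * b) + f a * b := rfl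

theorem range_hochschildDelta_le (B : Type*) [Ring B] [Algebra ℂ B] :
    LinearMap.range (hochschildDelta B) ≤ hochschildCocycles B := by
  rintro _ ⟨f, rfl⟩ a b c
  simp only [hochschildDelta_apply, mul_add, add_mul, mul_sub, sub_mul, mul_assoc]
  abel

/-- `HH²(B)`, as Hochschild `2`-cocycles modulo `2`-coboundaries. -/
abbrev HH2 (B : Type*) [Ring B] [Algebra ℂ B] : Type _ :=
  hochschildCocycles B ⧸ (LinearMap.range (hochschildDelta B)).submoduleOf (hochschildCocycles B)

/-- An `ℕ`-indexed family of subspaces extended by zero to negative degrees. -/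
def extendDegree {B : Type*} [AddCommGroup B] [Module ℂ B] (F : ℕ → Submodule ℂ B) :
    ℤ → Submodule ℂ B
  | Int.ofNat d => F d
  | Int.negSucc _ => ⊥

/-- The bilinear maps `μ` of degree `e` with respect to the grading `F`:
`μ(F i, F j) ⊆ F (i + j + e)`, negative degrees being zero. -/
def bilinOfDegree {B : Type*} [AddCommGroup B] [Module ℂ B] (F : ℕ → Submodule ℂ B) (e : ℤ) :
    Submodule ℂ (TwoCochain B) where
  carrier := {μ | ∀ i j : ℕ, ∀ a ∈ F i, ∀ b ∈ F j, μ a b ∈ extendDegree F (i + j + e)}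
  zero_mem' := by
    intro i j a _ b _
    exact Submodule.zero_mem _
  add_mem' := by
    intro μ ν hμ hν i j a ha b hb
    exact Submodule.add_mem _ (hμ i j a ha b hb) (hν i j a ha b hb)
  smul_mem' := by
    intro r μ hμ i j a ha b hb
    exact Submodule.smul_mem _ r (hμ i j a ha b hb)

/-- The constant Hochschild `2`-cocycles, i.e. those of degree `-2`. -/
def constantCocycles {B : Type*} [Ring B] [Algebra ℂ B] (F : ℕ → Submodule ℂ B) :
    Submodule ℂ (hochschildCocycles B) :=
  (bilinOfDegree F (-2)).submoduleOf (hochschildCocycles B)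

/-- The subspace of `HH²(B)` of classes represented by constant Hochschild `2`-cocycles. -/
def constantHH2 {B : Type*} [Ring B] [Algebra ℂ B] (F : ℕ → Submodule ℂ B) :
    Submodule ℂ (HH2 B) :=
  (constantCocycles F).map (Submodule.mkQ _)

/-- The class in `constantHH2` of a constant Hochschild `2`-cocycle. -/
def constantClass {B : Type*} [Ring B] [Algebra ℂ B] (F : ℕ → Submodule ℂ B)
    (μ : hochschildCocycles B) (hμ : μ ∈ constantCocycles F) : constantHH2 F :=
  ⟨Submodule.Quotient.mk μ, Submodule.mem_map_of_mem hμ⟩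

/-! ### The algebra `S_q(V) #_α G` for a diagonal action -/

/-- `S_q(V) #_α G`, where `S_q(V) = ℂ⟨v₁, …, vₙ ∣ vᵢ vⱼ = qᵢⱼ vⱼ vᵢ⟩`. -/
abbrev QuantumSkew {n : ℕ} {G V : Type*} [Group G] [AddCommGroup V] [Module ℂ V]
    {v : Module.Basis (Fin n) ℂ V} {ρ : Representation ℂ G V} (q : Fin n → Fin n → ℂ)
    (hρ : IsDiagonalAction v ρ) (α : NormalizedTwoCocycle G) : Type _ :=
  TwistedSkewGroupAlgebra (quantumAction q hρ) α

/-- The quantum exterior algebra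
`Λ_{q⁻¹}(V*) = ℂ⟨v₁*, …, vₙ* ∣ vᵢ* vⱼ* = -qᵢⱼ⁻¹ vⱼ* vᵢ*⟩`. -/
abbrev DualQuantumExterior {n : ℕ} {V : Type*} [AddCommGroup V] [Module ℂ V]
    (v : Module.Basis (Fin n) ℂ V) (q : Fin n → Fin n → ℂ) : Type _ :=
  QuantumAlgebra v.dualBasis (fun i j => -(q i j)⁻¹)

namespace QuantumSkew

/-- The grading of `S_q(V) #_α G`, with each `vᵢ` of degree one and each `t_g` of degree zero. -/
def degreePart {n : ℕ} {G V : Type*} [Group G] [AddCommGroup V] [Module ℂ V]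
    {v : Module.Basis (Fin n) ℂ V} {ρ : Representation ℂ G V} (q : Fin n → Fin n → ℂ)
    (hρ : IsDiagonalAction v ρ) (α : NormalizedTwoCocycle G) (d : ℕ) :
    Submodule ℂ (QuantumSkew q hρ α) :=
  ⨅ g, (QuantumAlgebra.degreePart v q d).comap (TwistedSkewGroupAlgebra.coeff _ α g)

/-- The element `vᵢ` of `S_q(V) #_α G`. -/
def gen {n : ℕ} {G V : Type*} [Group G] [AddCommGroup V] [Module ℂ V]
    {v : Module.Basis (Fin n) ℂ V} {ρ : Representation ℂ G V} (q : Fin n → Fin n → ℂ)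
    (hρ : IsDiagonalAction v ρ) (α : NormalizedTwoCocycle G) (i : Fin n) : QuantumSkew q hρ α :=
  TwistedSkewGroupAlgebra.of _ α 1 (QuantumAlgebra.ι v q (v i))

/-- The element `vᵢ*` of `Λ_{q⁻¹}(V*)`. -/
def dualGen {n : ℕ} {V : Type*} [AddCommGroup V] [Module ℂ V]
    (v : Module.Basis (Fin n) ℂ V) (q : Fin n → Fin n → ℂ) (i : Fin n) :
    DualQuantumExterior v q :=
  QuantumAlgebra.ι v.dualBasis _ (v.dualBasis i)

/-- The space `(S_q(V) #_α G) ⊗ Λ_{q⁻¹}(V*)` of cochains of the quantum Koszul complex that computes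
`HH(S_q(V), S_q(V) #_α G)`; in degree `m` it is `(S_q(V) #_α G) ⊗ Λᵐ_{q⁻¹}(V*)`. -/
abbrev KoszulCochain {n : ℕ} {G V : Type*} [Group G] [AddCommGroup V] [Module ℂ V]
    {v : Module.Basis (Fin n) ℂ V} {ρ : Representation ℂ G V} (q : Fin n → Fin n → ℂ)
    (hρ : IsDiagonalAction v ρ) (α : NormalizedTwoCocycle G) : Type _ :=
  QuantumSkew q hρ α ⊗[ℂ] DualQuantumExterior v q

/-- The Koszul cochain `b ⊗ v_r* ∧ v_s*`. -/
def wedge {n : ℕ} {G V : Type*} [Group G] [AddCommGroup V] [Module ℂ V]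
    {v : Module.Basis (Fin n) ℂ V} {ρ : Representation ℂ G V} (q : Fin n → Fin n → ℂ)
    (hρ : IsDiagonalAction v ρ) (α : NormalizedTwoCocycle G) (b : QuantumSkew q hρ α)
    (r s : Fin n) : KoszulCochain q hρ α :=
  b ⊗ₜ[ℂ] (dualGen v q r * dualGen v q s)

/-- The differential of the quantum Koszul complex on cochains of degree two,
`d(b ⊗ ω) = ∑ᵢ (vᵢ b ⊗ vᵢ* ∧ ω - b vᵢ ⊗ ω ∧ vᵢ*)`. In the basis of increasing wedges, moving `vᵢ*` to its
place by `vᵢ* ∧ vⱼ* = -qⱼᵢ vⱼ* ∧ vᵢ*` gives the usual signs and products of the `qᵢⱼ`: for `i < j < k`, the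
coefficient of `vᵢ* ∧ vⱼ* ∧ vₖ*` in `d(b ⊗ vⱼ* ∧ vₖ*)` is `vᵢ b - qᵢⱼ qᵢₖ b vᵢ`, for example. -/
def koszulD {n : ℕ} {G V : Type*} [Group G] [AddCommGroup V] [Module ℂ V]
    {v : Module.Basis (Fin n) ℂ V} {ρ : Representation ℂ G V} (q : Fin n → Fin n → ℂ)
    (hρ : IsDiagonalAction v ρ) (α : NormalizedTwoCocycle G) :
    KoszulCochain q hρ α →ₗ[ℂ] KoszulCochain q hρ α :=
  ∑ i, (TensorProduct.map (LinearMap.mulLeft ℂ (gen q hρ α i))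
          (LinearMap.mulLeft ℂ (dualGen v q i)) -
        TensorProduct.map (LinearMap.mulRight ℂ (gen q hρ α i))
          (LinearMap.mulRight ℂ (dualGen v q i)))

/-- The action of `g ∈ G` on Koszul cochains, `b ⊗ ω ↦ t_g b (t_g)⁻¹ ⊗ ᵍω`, where `G` acts on `V*` by the
contragredient representation. -/
def koszulAct {n : ℕ} {G V : Type*} [Group G] [AddCommGroup V] [Module ℂ V]
    {v : Module.Basis (Fin n) ℂ V} {ρ : Representation ℂ G V} (q : Fin n → Fin n → ℂ)
    (hρ : IsDiagonalAction v ρ) (α : NormalizedTwoCocycle G) (g : G) :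
    KoszulCochain q hρ α →ₗ[ℂ] KoszulCochain q hρ α :=
  TensorProduct.map (TwistedSkewGroupAlgebra.conj _ α g)
    (quantumAction (fun i j => -(q i j)⁻¹) hρ.dual g).toLinearMap

/-- The `G`-invariant Koszul `2`-cocycles that lie in `ℂ^α G ⊗ Λ²_{q⁻¹}(V*)`. -/
def constantKoszul {n : ℕ} {G V : Type*} [Group G] [AddCommGroup V] [Module ℂ V]
    {v : Module.Basis (Fin n) ℂ V} {ρ : Representation ℂ G V} (q : Fin n → Fin n → ℂ)
    (hρ : IsDiagonalAction v ρ) (α : NormalizedTwoCocycle G) :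
    Submodule ℂ (KoszulCochain q hρ α) :=
  Submodule.span ℂ {x | ∃ g r s, x = wedge q hρ α (TwistedSkewGroupAlgebra.t _ α g) r s} ⊓
    LinearMap.ker (koszulD q hρ α) ⊓
    ⨅ g, LinearMap.ker (koszulAct q hρ α g - LinearMap.id)

/-- The Koszul `2`-cochain of a Hochschild `2`-cochain `μ` of `S_q(V) #_α G`: the restriction of `μ` to
`S_q(V) ⊗ S_q(V)` pulled back along the chain map
`vᵢ ∧ vⱼ ↦ 1 ⊗ vᵢ ⊗ vⱼ ⊗ 1 - qᵢⱼ ⊗ vⱼ ⊗ vᵢ ⊗ 1` from the Koszul to the bar resolution. As a map on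
`Λ²_q(V)` it is the quantum skew-symmetrization `vᵢ ∧ vⱼ ↦ μ(vᵢ, vⱼ) - qᵢⱼ μ(vⱼ, vᵢ)`. -/
def koszulForm {n : ℕ} {G V : Type*} [Group G] [AddCommGroup V] [Module ℂ V]
    {v : Module.Basis (Fin n) ℂ V} {ρ : Representation ℂ G V} (q : Fin n → Fin n → ℂ)
    (hρ : IsDiagonalAction v ρ) (α : NormalizedTwoCocycle G)
    (μ : TwoCochain (QuantumSkew q hρ α)) :
    KoszulCochain q hρ α :=
  ∑ r, ∑ s, if r < s then
    wedge q hρ α (μ (gen q hρ α r) (gen q hρ α s) - q r s • μ (gen q hρ α s) (gen q hρ α r)) r s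
  else 0

/-- The index set: triples `(a, r, s)` with `a` in the set `R` and `r < s`, such that
`q_{rr'} q_{sr'} = λ_{a,r'}` for all `r' ∉ {r, s}`, and `λ_{h,r} λ_{h,s} = α(h,a) / α(a,h)` for all `h` in
the centralizer of `a`. -/
def Index {n : ℕ} {G V : Type*} [Group G] [AddCommGroup V] [Module ℂ V]
    (v : Module.Basis (Fin n) ℂ V) (ρ : Representation ℂ G V) (q : Fin n → Fin n → ℂ)
    (α : NormalizedTwoCocycle G) (R : Set G) : Set (G × Fin n × Fin n) :=
  {p | p.1 ∈ R ∧ p.2.1 < p.2.2 ∧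
    (∀ r', r' ≠ p.2.1 → r' ≠ p.2.2 → q p.2.1 r' * q p.2.2 r' = eigenvalue v ρ p.1 r') ∧
    ∀ h ∈ Subgroup.centralizer {p.1},
      eigenvalue v ρ h p.2.1 * eigenvalue v ρ h p.2.2 = (α h p.1 : ℂ) / (α p.1 h : ℂ)}

/-- The element `∑_{g ∈ T} α(g,a)/α(gag⁻¹,g) λ_{g,r}⁻¹ λ_{g,s}⁻¹ t_{gag⁻¹} ⊗ v_r* ∧ v_s*`. -/
def basisElement {n : ℕ} {G V : Type*} [Group G] [AddCommGroup V] [Module ℂ V]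
    {v : Module.Basis (Fin n) ℂ V} {ρ : Representation ℂ G V} (q : Fin n → Fin n → ℂ)
    (hρ : IsDiagonalAction v ρ) (α : NormalizedTwoCocycle G) (T : Finset G) (a : G)
    (r s : Fin n) : KoszulCochain q hρ α :=
  ∑ g ∈ T, ((α g a : ℂ) / (α (g * a * g⁻¹) g : ℂ) *
      (eigenvalue v ρ g r)⁻¹ * (eigenvalue v ρ g s)⁻¹) •
    wedge q hρ α (TwistedSkewGroupAlgebra.t _ α (g * a * g⁻¹)) r s

end QuantumSkew

end

/-! Write `B` for the algebra and `A` for `S_q(V)`. A constant cocycle `μ` vanishes for degree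
reasons on every pair `(t_g, t_h)`, `(t_g, vᵢ)`, `(vᵢ, t_g)`, and `μ(vᵢ, vⱼ)` lies in `ℂ^α G`.
Everything rests on the skew parts `μ(v_r, v_s) - q_{rs} μ(v_s, v_r)`.

The form is closed and invariant. Alternating the cocycle identity over the six orderings of `v_l,
v_r, v_s` and reading off the coefficient of `v_l t_g` shows that `t_g ⊗ v_r* ∧ v_s*` occurs only if
`q_{rl} q_{sl} = λ_{g,l}` for all `l ∉ {r, s}` (`isAdmissible_of_skewPart`); each such term is
closed by itself. The cocycle identities that contain one `t_g` give invariance (`conj_skewPart`).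

The kernel is the space of constant coboundaries. The skew part of a coboundary is a combination of
products with some `vᵢ` as a factor; being of degree zero, it vanishes
(`koszulForm_hochschildDelta`). Conversely, if all skew parts vanish, then in the square-zero
extension of `B` defined by `μ` the lifts `(vᵢ, 0)` and `(t_g, 0)` still satisfy the relations of
`B`, so the extension splits and `μ` is a coboundary (`mem_range_hochschildDelta_of_skewPart`).

Surjectivity. An invariant closed form is a combination of admissible terms `t_a ⊗ v_r* ∧ v_s*` and
equals its own average over `G`. For an admissible term the cup product `∂_r(x) σ(∂_s(y)) t_a` of
two quantum partial derivatives is a cocycle on `A`, because admissibility makes the two twists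
compose to the action of `a` (`isBaseCocycle_cupCochain`). Its average over `G` is equivariant and
extends to `B` (`extend_mem_hochschildCocycles`).

The basis. Invariance determines all coordinates from those at conjugacy class representatives; a
coordinate there can be nonzero only if the triple is admissible and the centralizer fixes the
corresponding term. The orbit sums are dual to the remaining coordinates (`coord_basisElement`,
`indexCoord_injective`). -/

noncomputable section

/-! ### Universal property and skew derivations of quantum algebras. -/

namespace QuantumAlgebra

variable {n : ℕ} {W : Type*} [AddCommGroup W] [Module ℂ W] {w : Module.Basis (Fin n) ℂ W}
  {c : Fin n → Fin n → ℂ} {A : Type*} [Ring A] [Algebra ℂ A]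

/-- The universal property: elements `xᵢ` with `xᵢ xⱼ = cᵢⱼ xⱼ xᵢ` determine an algebra map. -/
def lift (w : Module.Basis (Fin n) ℂ W) (x : Fin n → A)
    (hx : ∀ i j, x i * x j = c i j • (x j * x i)) : QuantumAlgebra w c →ₐ[ℂ] A :=
  RingQuot.liftAlgHom ℂ ⟨TensorAlgebra.lift ℂ (w.constr ℂ x), by
    rintro _ _ ⟨i, j⟩
    simp [hx i j]⟩

@[simp]
theorem lift_ι (x : Fin n → A) (hx : ∀ i j, x i * x j = c i j • (x j * x i)) (i : Fin n) :
    lift w x hx (ι w c (w i)) = x i := by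
  refine (RingQuot.liftAlgHom_mkAlgHom_apply ℂ _ _ _).trans ?_
  simp

theorem hom_ext_basis {f f' : QuantumAlgebra w c →ₐ[ℂ] A}
    (h : ∀ i, f (ι w c (w i)) = f' (ι w c (w i))) : f = f' :=
  hom_ext fun x => LinearMap.congr_fun
    (w.ext h : f.toLinearMap ∘ₗ ι w c = f'.toLinearMap ∘ₗ ι w c) x

theorem induction {P : QuantumAlgebra w c → Prop} (scalar : ∀ r : ℂ, P (algebraMap ℂ _ r))
    (gen : ∀ i, P (ι w c (w i))) (mul : ∀ x y, P x → P y → P (x * y))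
    (add : ∀ x y, P x → P y → P (x + y)) (x : QuantumAlgebra w c) : P x := by
  let S : Subalgebra ℂ (QuantumAlgebra w c) :=
    { carrier := {x | P x}
      mul_mem' := fun {a b} ha hb => mul a b ha hb
      add_mem' := fun {a b} ha hb => add a b ha hb
      algebraMap_mem' := scalar }
  -- The universal property gives a map into the subalgebra where `P` holds. Followed by the
  -- inclusion it fixes the generators, so it is the identity.
  let f : QuantumAlgebra w c →ₐ[ℂ] S := lift w (fun i => ⟨ι w c (w i), gen i⟩)
    fun i j => Subtype.ext (ι_mul_ι w c i j)
  have hf : S.val.comp f = AlgHom.id ℂ _ := hom_ext_basis fun i => by simp [f]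
  have hx : (f x : QuantumAlgebra w c) = x := AlgHom.congr_fun hf x
  exact hx ▸ (f x).2

/-- The algebra endomorphism `wᵢ ↦ sᵢ wᵢ`. -/
def scale (w : Module.Basis (Fin n) ℂ W) (c : Fin n → Fin n → ℂ) (s : Fin n → ℂ) :
    QuantumAlgebra w c →ₐ[ℂ] QuantumAlgebra w c :=
  lift w (fun i => s i • ι w c (w i)) fun i j => by
    rw [smul_mul_smul_comm, smul_mul_smul_comm, ι_mul_ι, smul_comm, mul_comm]

@[simp]
theorem scale_ι (s : Fin n → ℂ) (i : Fin n) :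
    scale w c s (ι w c (w i)) = s i • ι w c (w i) := lift_ι _ _ i

/-- The scalars `sⱼ` admit a skew derivation `∂` along `w_r` with twist `wⱼ ↦ sⱼ wⱼ`. -/
structure IsSkewTwist (c : Fin n → Fin n → ℂ) (r : Fin n) (s : Fin n → ℂ) : Prop where
  twist_eq : ∀ j, j ≠ r → s j = c r j
  mul_eq_one : ∀ j, j ≠ r → c j r * c r j = 1
  diag : 1 + s r = c r r * (1 + s r)

/-- The algebra map `x ↦ !![x, ∂ x; 0, σ x]` that encodes a skew derivation. -/
def triangular (w : Module.Basis (Fin n) ℂ W) {r : Fin n} {s : Fin n → ℂ}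
    (h : IsSkewTwist c r s) :
    QuantumAlgebra w c →ₐ[ℂ] Matrix (Fin 2) (Fin 2) (QuantumAlgebra w c) :=
  lift w (fun i => !![ι w c (w i), (if i = r then 1 else 0); 0, s i • ι w c (w i)]) fun i j => by
    have h0 := ι_mul_ι w c i j
    ext a b
    fin_cases a <;> fin_cases b
    · simp only [Matrix.mul_apply, Fin.sum_univ_two, Matrix.smul_apply]
      simpa using h0
    · simp only [Matrix.mul_apply, Fin.sum_univ_two, Matrix.smul_apply]
      -- The four cases of `wᵢ δⱼᵣ + δᵢᵣ sⱼ wⱼ = cᵢⱼ (wⱼ δᵢᵣ + δⱼᵣ sᵢ wᵢ)`; the fields of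
      -- `IsSkewTwist` are what they require. At `i = j = r` the scalar `s r` is free if `c r r = 1`
      -- and is forced to be `-1` if `c r r = -1`.
      by_cases hi : i = r <;> by_cases hj : j = r
      · subst hi hj
        have := congrArg (· • ι w c (w j)) h.diag
        simp only [mul_smul, add_smul, one_smul] at this
        simpa using this
      · subst hi
        simp [hj, h.twist_eq j hj]
      · subst hj
        simp [hi, h.twist_eq i hi, smul_smul, h.mul_eq_one i hi]
      · simp [hi, hj]
    · simp [Matrix.mul_apply, Fin.sum_univ_two]
    · simp only [Matrix.mul_apply, Fin.sum_univ_two, Matrix.smul_apply]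
      simp [h0, smul_smul, mul_comm, mul_left_comm]

/-- The skew derivation `∂` with `∂ wⱼ = δ_{jr}` and `∂(xy) = x ∂y + ∂x σ(y)`. -/
def skewDer (w : Module.Basis (Fin n) ℂ W) {r : Fin n} {s : Fin n → ℂ}
    (h : IsSkewTwist c r s) : QuantumAlgebra w c →ₗ[ℂ] QuantumAlgebra w c where
  toFun x := triangular w h x 0 1
  map_add' x y := by simp
  map_smul' a x := by simp

section

variable {r : Fin n} {s : Fin n → ℂ} (h : IsSkewTwist c r s)

/-- Upper triangular shape and algebra maps on the diagonal are what make the upper right entry obey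
the skew Leibniz rule. -/
theorem triangular_apply (x : QuantumAlgebra w c) :
    triangular w h x 0 0 = x ∧ triangular w h x 1 0 = 0 ∧ triangular w h x 1 1 = scale w c s x := by
  induction x using induction with
  | scalar a => simp [AlgHom.commutes, Matrix.algebraMap_matrix_apply]
  | gen i => simp [triangular]
  | mul x y hx hy => simp [Matrix.mul_apply, Fin.sum_univ_two, hx, hy]
  | add x y hx hy => simp [hx, hy]

theorem skewDer_mul (x y : QuantumAlgebra w c) :
    skewDer w h (x * y) = x * skewDer w h y + skewDer w h x * scale w c s y := by
  change triangular w h (x * y) 0 1 = _ * triangular w h y 0 1 + triangular w h x 0 1 * _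
  rw [map_mul, Matrix.mul_apply, Fin.sum_univ_two, (triangular_apply h x).1,
    (triangular_apply h y).2.2]

theorem skewDer_ι (i : Fin n) : skewDer w h (ι w c (w i)) = if i = r then 1 else 0 := by
  change triangular w h (ι w c (w i)) 0 1 = _
  simp [triangular]

theorem skewDer_one : skewDer w h (1 : QuantumAlgebra w c) = 0 := by
  change triangular w h 1 0 1 = _
  simp

end

/-! #### Degrees -/

theorem map_degreePart_le (f : QuantumAlgebra w c →ₐ[ℂ] QuantumAlgebra w c)
    (hf : ∀ i, f (ι w c (w i)) ∈ LinearMap.range (ι w c)) {d : ℕ} {x : QuantumAlgebra w c}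
    (hx : x ∈ degreePart w c d) : f x ∈ degreePart w c d := by
  have h1 : (LinearMap.range (ι w c)).map f.toLinearMap ≤ LinearMap.range (ι w c) := by
    rintro _ ⟨_, ⟨x, rfl⟩, rfl⟩
    rw [← w.sum_repr x]
    simp only [map_sum, map_smul, AlgHom.toLinearMap_apply]
    exact Submodule.sum_mem _ fun i _ => Submodule.smul_mem _ _ (hf i)
  have h2 : (degreePart w c d).map f.toLinearMap ≤ degreePart w c d := by
    unfold degreePart
    rw [Submodule.map_pow]
    exact pow_le_pow_left' h1 d
  exact h2 (Submodule.mem_map_of_mem hx)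

theorem mem_degreePart_zero {x : QuantumAlgebra w c} :
    x ∈ degreePart w c 0 ↔ ∃ a : ℂ, a • (1 : QuantumAlgebra w c) = x := by
  rw [degreePart, pow_zero, Submodule.mem_one]
  simp [Algebra.algebraMap_eq_smul_one]

theorem ι_mem_degreePart (u : W) : ι w c u ∈ degreePart w c 1 := by
  rw [degreePart, pow_one]
  exact ⟨_, rfl⟩

theorem mul_mem_degreePart {d e : ℕ} {x y : QuantumAlgebra w c} (hx : x ∈ degreePart w c d)
    (hy : y ∈ degreePart w c e) : x * y ∈ degreePart w c (d + e) := by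
  rw [degreePart, pow_add]
  exact Submodule.mul_mem_mul hx hy

theorem scale_mem_degreePart (s : Fin n → ℂ) {d : ℕ} {x : QuantumAlgebra w c}
    (hx : x ∈ degreePart w c d) : scale w c s x ∈ degreePart w c d :=
  map_degreePart_le _ (fun i => by rw [scale_ι]; exact Submodule.smul_mem _ _ ⟨_, rfl⟩) hx

theorem skewDer_ι_mem {r : Fin n} {s : Fin n → ℂ} (h : IsSkewTwist c r s) (u : W) :
    skewDer w h (ι w c u) ∈ degreePart w c 0 := by
  rw [← w.sum_repr u]
  simp only [map_sum, map_smul]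
  refine Submodule.sum_mem _ fun i _ => Submodule.smul_mem _ _ ?_
  rw [mem_degreePart_zero, skewDer_ι]
  exact ⟨if i = r then 1 else 0, by split_ifs <;> simp⟩

theorem skewDer_eq_zero {r : Fin n} {s : Fin n → ℂ} (h : IsSkewTwist c r s)
    {x : QuantumAlgebra w c} (hx : x ∈ degreePart w c 0) : skewDer w h x = 0 := by
  obtain ⟨a, rfl⟩ := mem_degreePart_zero.1 hx
  rw [map_smul, skewDer_one, smul_zero]

/-- Split off a linear factor: in `∂(u z) = u ∂z + ∂u σ(z)` the factor `∂u` is a scalar and `σ`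
preserves degrees. -/
theorem skewDer_mem_degreePart {r : Fin n} {s : Fin n → ℂ} (h : IsSkewTwist c r s) {d : ℕ}
    {x : QuantumAlgebra w c} (hx : x ∈ degreePart w c (d + 1)) :
    skewDer w h x ∈ degreePart w c d := by
  induction d generalizing x with
  | zero =>
    rw [degreePart, pow_one] at hx
    obtain ⟨u, rfl⟩ := hx
    exact skewDer_ι_mem h u
  | succ d ih =>
    rw [degreePart, pow_succ'] at hx
    induction hx using Submodule.mul_induction_on' with
    | mem_mul_mem y hy z hz =>
      obtain ⟨u, rfl⟩ := hy
      rw [skewDer_mul]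
      refine add_mem ?_ ?_
      · have := mul_mem_degreePart (ι_mem_degreePart (w := w) (c := c) u) (ih hz)
        rwa [add_comm] at this
      · have := mul_mem_degreePart (skewDer_ι_mem h u) (scale_mem_degreePart s hz)
        rwa [zero_add] at this
    | add y _ z _ hy hz => rw [map_add]; exact add_mem hy hz

end QuantumAlgebra


/-! ### Characters that detect coefficients in degrees zero and one. -/

namespace QuantumAlgebra

variable {n : ℕ} {W : Type*} [AddCommGroup W] [Module ℂ W]

/-- The augmentation, which kills all generators. -/
def augmentation (w : Module.Basis (Fin n) ℂ W) (c : Fin n → Fin n → ℂ) :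
    QuantumAlgebra w c →ₐ[ℂ] ℂ :=
  lift w (fun _ => 0) (by simp)

@[simp]
theorem augmentation_ι (w : Module.Basis (Fin n) ℂ W) (c : Fin n → Fin n → ℂ) (x : W) :
    augmentation w c (ι w c x) = 0 := by
  rw [← w.sum_repr x]
  simp only [map_sum, map_smul, augmentation, lift_ι, smul_zero, Finset.sum_const_zero]

/-- The character `wᵢ ↦ δᵢₗ`. -/
def character (w : Module.Basis (Fin n) ℂ W) {c : Fin n → Fin n → ℂ} (hc : ∀ i, c i i = 1)
    (l : Fin n) : QuantumAlgebra w c →ₐ[ℂ] ℂ :=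
  lift w (fun i => if i = l then 1 else 0) fun i j => by
    -- Both sides vanish unless `i = j = l`, so only the diagonal entry of `c` matters.
    by_cases hi : i = l <;> by_cases hj : j = l <;> simp [hi, hj, hc]

@[simp]
theorem character_ι {w : Module.Basis (Fin n) ℂ W} {c : Fin n → Fin n → ℂ}
    (hc : ∀ i, c i i = 1) (l i : Fin n) :
    character w hc l (ι w c (w i)) = if i = l then 1 else 0 := lift_ι _ _ i

end QuantumAlgebra

/-! ### Eigenvalues of diagonal actions -/

section Eigenvalue

variable {n : ℕ} {G V : Type*} [Group G] [AddCommGroup V] [Module ℂ V]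
  {v : Module.Basis (Fin n) ℂ V} {ρ : Representation ℂ G V}

theorem eigenvalue_one (i : Fin n) : eigenvalue v ρ 1 i = 1 := by
  simp [eigenvalue]

theorem IsDiagonalAction.eigenvalue_mul (hρ : IsDiagonalAction v ρ) (g h : G) (i : Fin n) :
    eigenvalue v ρ (g * h) i = eigenvalue v ρ g i * eigenvalue v ρ h i := by
  rw [eigenvalue, map_mul, Module.End.mul_apply, hρ.apply_eq h, map_smul, hρ.apply_eq g]
  simp [mul_comm]

theorem IsDiagonalAction.eigenvalue_inv (hρ : IsDiagonalAction v ρ) (g : G) (i : Fin n) :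
    eigenvalue v ρ g⁻¹ i = (eigenvalue v ρ g i)⁻¹ := by
  refine eq_inv_of_mul_eq_one_left ?_
  rw [← hρ.eigenvalue_mul, inv_mul_cancel, eigenvalue_one]

theorem IsDiagonalAction.eigenvalue_ne_zero (hρ : IsDiagonalAction v ρ) (g : G) (i : Fin n) :
    eigenvalue v ρ g i ≠ 0 := by
  refine left_ne_zero_of_mul_eq_one (b := eigenvalue v ρ g⁻¹ i) ?_
  rw [← hρ.eigenvalue_mul, mul_inv_cancel, eigenvalue_one]

theorem IsDiagonalAction.dual_apply (hρ : IsDiagonalAction v ρ) (g : G) (i : Fin n) :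
    ρ.dual g (v.dualBasis i) = (eigenvalue v ρ g i)⁻¹ • v.dualBasis i := by
  refine v.ext fun j => ?_
  have : ρ.dual g (v.dualBasis i) (v j) = v.dualBasis i (ρ g⁻¹ (v j)) := rfl
  rw [this, hρ.apply_eq, hρ.eigenvalue_inv]
  by_cases hij : j = i
  · subst hij; simp
  · simp [hij]

end Eigenvalue

/-! ### Twisted skew group algebras -/

namespace TwistedSkewGroupAlgebra

variable {G A : Type*} [Group G] [Ring A] [Algebra ℂ A] {φ : G →* (A →ₐ[ℂ] A)}
  {α : NormalizedTwoCocycle G}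

theorem ext_coeff {x y : TwistedSkewGroupAlgebra φ α} (h : ∀ g, coeff φ α g x = coeff φ α g y) :
    x = y := Finsupp.ext h

open Classical in
theorem coeff_of (g h : G) (a : A) : coeff φ α g (of φ α h a) = if h = g then a else 0 :=
  Finsupp.single_apply

theorem eq_sum [Fintype G] (x : TwistedSkewGroupAlgebra φ α) :
    x = ∑ g, of φ α g (coeff φ α g x) := by
  classical
  refine ext_coeff fun g => ?_
  simp [map_sum, coeff_of]

theorem one_def : (1 : TwistedSkewGroupAlgebra φ α) = of φ α 1 1 := rfl

theorem t_one : t φ α 1 = 1 := rfl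

theorem of_one_mul_of (g : G) (a b : A) : of φ α 1 a * of φ α g b = of φ α g (a * b) := by
  rw [of_mul_of, α.one_left, map_one, one_mul]
  simp

theorem of_mul_of_one (g : G) (a b : A) : of φ α g a * of φ α 1 b = of φ α g (a * φ g b) := by
  rw [of_mul_of, α.right_one, mul_one]
  simp

theorem of_one_mul_t (g : G) (a : A) : of φ α 1 a * t φ α g = of φ α g a := by
  rw [t, of_one_mul_of, mul_one]

theorem t_mul_of_one (g : G) (a : A) : t φ α g * of φ α 1 a = of φ α g (φ g a) := by
  rw [t, of_mul_of_one, one_mul]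

theorem t_mul_of_one' (g : G) (a : A) : t φ α g * of φ α 1 a = of φ α 1 (φ g a) * t φ α g := by
  rw [t_mul_of_one, of_one_mul_t]

theorem t_mul_t (g h : G) : t φ α g * t φ α h = (α g h : ℂ) • t φ α (g * h) := by
  rw [t, t, of_mul_of, map_one, mul_one, map_smul]
  rfl

theorem coeff_of_one_mul (g : G) (a : A) (x : TwistedSkewGroupAlgebra φ α) :
    coeff φ α g (of φ α 1 a * x) = a * coeff φ α g x := by
  classical
  have : coeff φ α g ∘ₗ LinearMap.mulLeft ℂ (of φ α 1 a) =
      LinearMap.mulLeft ℂ a ∘ₗ coeff φ α g := hom_ext fun h b => by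
    simp only [LinearMap.comp_apply, LinearMap.mulLeft_apply, of_one_mul_of, coeff_of]
    split_ifs <;> simp
  exact LinearMap.congr_fun this x

theorem coeff_mul_of_one (g : G) (a : A) (x : TwistedSkewGroupAlgebra φ α) :
    coeff φ α g (x * of φ α 1 a) = coeff φ α g x * φ g a := by
  classical
  have : coeff φ α g ∘ₗ LinearMap.mulRight ℂ (of φ α 1 a) =
      LinearMap.mulRight ℂ (φ g a) ∘ₗ coeff φ α g := hom_ext fun h b => by
    simp only [LinearMap.comp_apply, LinearMap.mulRight_apply, of_mul_of_one, coeff_of]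
    split_ifs with hh
    · rw [hh]
    · simp
  exact LinearMap.congr_fun this x

theorem tInv_mul_t (g : G) : tInv φ α g * t φ α g = 1 := by
  -- Here the cocycle identity reads `α(g, g⁻¹) = α(g⁻¹, g)`, so the right inverse is also a left
  -- inverse.
  have h := α.cocycle g g⁻¹ g
  rw [mul_inv_cancel, inv_mul_cancel, α.one_left, α.right_one, mul_one, mul_one] at h
  rw [tInv, smul_mul_assoc, t_mul_t, inv_mul_cancel, h, smul_smul,
    inv_mul_cancel₀ (Units.ne_zero _), one_smul, t_one]

theorem conj_apply (g : G) (x : TwistedSkewGroupAlgebra φ α) :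
    conj φ α g x = t φ α g * x * tInv φ α g := rfl

theorem conj_mul_t (g : G) (x : TwistedSkewGroupAlgebra φ α) :
    conj φ α g x * t φ α g = t φ α g * x := by
  rw [conj_apply, mul_assoc, tInv_mul_t, mul_one]

/-- A conjugate is determined by a relation free of inverses; the formulas for `conj` are verified
in this form. -/
theorem conj_eq {g : G} {x y : TwistedSkewGroupAlgebra φ α} (h : t φ α g * x = y * t φ α g) :
    conj φ α g x = y := by
  rw [conj_apply, h, mul_assoc, t_mul_tInv, mul_one]

theorem conj_mul_apply (g : G) (x y : TwistedSkewGroupAlgebra φ α) :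
    conj φ α g (x * y) = conj φ α g x * conj φ α g y :=
  conj_eq (by rw [mul_assoc, conj_mul_t, ← mul_assoc, ← mul_assoc, conj_mul_t])

/-- Since `t_{gh}` is a scalar multiple of `t_g t_h`, the scalar drops out and conjugation is an
honest action despite the twist. -/
theorem conj_mul (g h : G) (x : TwistedSkewGroupAlgebra φ α) :
    conj φ α (g * h) x = conj φ α g (conj φ α h x) := by
  refine conj_eq ?_
  have h1 : t φ α (g * h) = (α g h : ℂ)⁻¹ • (t φ α g * t φ α h) := by
    rw [t_mul_t, smul_smul, inv_mul_cancel₀ (Units.ne_zero _), one_smul]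
  rw [h1, smul_mul_assoc, mul_smul_comm, ← mul_assoc, conj_mul_t, mul_assoc, mul_assoc,
    conj_mul_t]

theorem conj_of_one (g : G) (a : A) : conj φ α g (of φ α 1 a) = of φ α 1 (φ g a) :=
  conj_eq (t_mul_of_one' g a)

theorem conj_t (g h : G) :
    conj φ α g (t φ α h) = ((α g h : ℂ) / (α (g * h * g⁻¹) g : ℂ)) • t φ α (g * h * g⁻¹) := by
  refine conj_eq ?_
  rw [smul_mul_assoc, t_mul_t, t_mul_t, smul_smul, div_mul_cancel₀ _ (Units.ne_zero _),
    inv_mul_cancel_right]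

end TwistedSkewGroupAlgebra


/-! ### Quantum Koszul cochains with values in the twisted group algebra -/

namespace QuantumSkew

open TwistedSkewGroupAlgebra QuantumAlgebra

variable {n : ℕ} {G V : Type*} [Group G] [AddCommGroup V] [Module ℂ V]
  {v : Module.Basis (Fin n) ℂ V} {ρ : Representation ℂ G V} {q : Fin n → Fin n → ℂ}
  {hρ : IsDiagonalAction v ρ} {α : NormalizedTwoCocycle G}

theorem dualGen_mul_dualGen (i j : Fin n) :
    dualGen v q i * dualGen v q j = (-(q i j)⁻¹) • (dualGen v q j * dualGen v q i) :=
  ι_mul_ι _ _ i j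

theorem dualGen_mul_self (hq1 : ∀ i, q i i = 1) (i : Fin n) :
    dualGen v q i * dualGen v q i = 0 := by
  have h := dualGen_mul_dualGen (v := v) (q := q) i i
  rw [hq1, inv_one, neg_smul, one_smul] at h
  have h2 : (2 : ℂ) • (dualGen v q i * dualGen v q i) = 0 := by
    rw [two_smul]
    nth_rewrite 2 [h]
    exact add_neg_cancel _
  exact (smul_eq_zero_iff_right two_ne_zero).1 h2

theorem dualGen_mul_mul (r s l : Fin n) :
    dualGen v q r * dualGen v q s * dualGen v q l =
      ((q r l)⁻¹ * (q s l)⁻¹) • (dualGen v q l * (dualGen v q r * dualGen v q s)) := by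
  rw [mul_assoc, dualGen_mul_dualGen s l, mul_smul_comm, ← mul_assoc, dualGen_mul_dualGen r l,
    smul_mul_assoc, smul_smul, mul_assoc]
  congr 1
  ring

theorem isSkewTwist_dual (hq0 : ∀ i j, q i j ≠ 0) (hq1 : ∀ i, q i i = 1)
    (hq : ∀ i j, q j i = (q i j)⁻¹) (r : Fin n) :
    IsSkewTwist (fun i j => -(q i j)⁻¹) r (fun j => -(q r j)⁻¹) where
  twist_eq _ _ := rfl
  mul_eq_one j _ := by
    have := hq0 j r
    rw [hq j r]
    field_simp
  diag := by simp [hq1]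

/-! ### Linear forms dual to wedges of two and three generators. -/

section Forms

variable (v) (hq0 : ∀ i j, q i j ≠ 0) (hq1 : ∀ i, q i i = 1) (hq : ∀ i j, q j i = (q i j)⁻¹)

/-- The quantum derivation `∂_r` of the quantum exterior algebra. -/
abbrev dualDer (r : Fin n) : DualQuantumExterior v q →ₗ[ℂ] DualQuantumExterior v q :=
  skewDer v.dualBasis (isSkewTwist_dual hq0 hq1 hq r)

theorem dualDer_mul (r i : Fin n) (x : DualQuantumExterior v q) :
    dualDer v hq0 hq1 hq r (dualGen v q i * x) =
      dualGen v q i * dualDer v hq0 hq1 hq r x +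
        if i = r then scale v.dualBasis _ (fun j => -(q r j)⁻¹) x else 0 := by
  rw [dualDer, skewDer_mul, dualGen, skewDer_ι]
  split_ifs <;> simp

theorem dualDer_gen (r i : Fin n) :
    dualDer v hq0 hq1 hq r (dualGen v q i) = if i = r then 1 else 0 := skewDer_ι _ _

theorem scale_dualGen (s : Fin n → ℂ) (i : Fin n) :
    scale v.dualBasis (fun i j => -(q i j)⁻¹) s (dualGen v q i) = s i • dualGen v q i :=
  scale_ι _ _

/-- The linear form that reads off the coefficient of `v_r* ∧ v_s*`. -/
def pairForm (r s : Fin n) : DualQuantumExterior v q →ₗ[ℂ] ℂ :=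
  (augmentation _ _).toLinearMap ∘ₗ dualDer v hq0 hq1 hq r ∘ₗ dualDer v hq0 hq1 hq s

theorem pairForm_mul (r s i j : Fin n) :
    pairForm v hq0 hq1 hq r s (dualGen v q i * dualGen v q j) =
      (if i = r then 1 else 0) * (if j = s then 1 else 0) -
        (if i = s then 1 else 0) * (if j = r then 1 else 0) * (q s j)⁻¹ := by
  have h1 : augmentation _ _ (dualGen v q i) = 0 := augmentation_ι _ _ _
  have h2 : augmentation _ _ (if i = r then scale v.dualBasis (fun i j => -(q i j)⁻¹)
      (fun j => -(q r j)⁻¹) (if j = s then 1 else 0) else 0) =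
      (if i = r then (1 : ℂ) else 0) * (if j = s then 1 else 0) := by
    split_ifs <;> simp
  have h3 : augmentation _ _ (dualDer v hq0 hq1 hq r
      (if i = s then (-(q s j)⁻¹) • dualGen v q j else 0)) =
      -((if i = s then (1 : ℂ) else 0) * (if j = r then 1 else 0) * (q s j)⁻¹) := by
    by_cases hi : i = s
    · rw [if_pos hi, if_pos hi, map_smul, dualDer_gen]
      split_ifs <;> simp
    · simp [hi]
  simp only [pairForm, LinearMap.comp_apply, dualDer_mul, dualDer_gen, scale_dualGen, map_add,
    AlgHom.toLinearMap_apply, map_mul, h1, h2, h3, zero_mul, zero_add, sub_eq_add_neg]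

/-- The exchanged term of `pairForm_mul` needs `i = s` and `j = r`, which the orderings exclude.
This duality gives the independence of the increasing wedges without a basis theorem for the whole
exterior algebra. -/
theorem pairForm_mul_of_lt {r s i j : Fin n} (hrs : r < s) (hij : i < j) :
    pairForm v hq0 hq1 hq r s (dualGen v q i * dualGen v q j) =
      if i = r ∧ j = s then 1 else 0 := by
  rw [pairForm_mul]
  by_cases h1 : i = r <;> by_cases h2 : j = s <;> by_cases h3 : i = s <;> by_cases h4 : j = r <;>
    simp [h1, h2, h3, h4] <;> omega

/-- The linear form that reads off the coefficient of `v_l* ∧ v_r* ∧ v_s*`, up to a nonzero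
factor. -/
def tripleForm (l r s : Fin n) : DualQuantumExterior v q →ₗ[ℂ] ℂ :=
  pairForm v hq0 hq1 hq r s ∘ₗ dualDer v hq0 hq1 hq l

/-- In the Leibniz expansion of `∂_l`, the terms that keep the leading `v_l*` are killed because `l
∉ {r, s}`; what remains is the twist of `vᵢ* ∧ vⱼ*`. -/
theorem tripleForm_mul {l r s : Fin n} (hr : l ≠ r) (hs : l ≠ s) (i j : Fin n) :
    tripleForm v hq0 hq1 hq l r s (dualGen v q l * (dualGen v q i * dualGen v q j)) =
      (q l i)⁻¹ * (q l j)⁻¹ * pairForm v hq0 hq1 hq r s (dualGen v q i * dualGen v q j) := by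
  have h (a : Fin n) : pairForm v hq0 hq1 hq r s (dualGen v q l * dualGen v q a) = 0 := by
    simp [pairForm_mul, hr, hs]
  simp only [tripleForm, LinearMap.comp_apply, dualDer_mul, dualDer_gen, scale_dualGen, mul_add,
    map_add, map_mul, if_true]
  rw [smul_mul_smul_comm, map_smul, smul_eq_mul, neg_mul_neg]
  split_ifs <;> simp [h]

end Forms

/-! ### Coordinates of Koszul cochains. -/

section Coordinates

variable (hρ α)

/-- The contraction of the second tensor factor with a linear form. -/
def contract (f : DualQuantumExterior v q →ₗ[ℂ] ℂ) :
    KoszulCochain q hρ α →ₗ[ℂ] QuantumSkew q hρ α :=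
  (TensorProduct.rid ℂ (QuantumSkew q hρ α)).toLinearMap ∘ₗ
    LinearMap.lTensor (QuantumSkew q hρ α) f

@[simp]
theorem contract_tmul (f : DualQuantumExterior v q →ₗ[ℂ] ℂ) (b : QuantumSkew q hρ α)
    (x : DualQuantumExterior v q) : contract hρ α f (b ⊗ₜ x) = f x • b := by
  simp [contract]

variable (hq0 : ∀ i j, q i j ≠ 0) (hq1 : ∀ i, q i i = 1) (hq : ∀ i j, q j i = (q i j)⁻¹)

/-- The coefficient of `t_g ⊗ v_r* ∧ v_s*`. -/
def coord (g : G) (r s : Fin n) : KoszulCochain q hρ α →ₗ[ℂ] ℂ :=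
  (augmentation v q).toLinearMap ∘ₗ coeff _ α g ∘ₗ contract hρ α (pairForm v hq0 hq1 hq r s)

open Classical in
theorem coord_wedge {r s i j : Fin n} (hrs : r < s) (hij : i < j) (g h : G) :
    coord hρ α hq0 hq1 hq g r s (wedge q hρ α (t _ α h) i j) =
      if h = g ∧ i = r ∧ j = s then 1 else 0 := by
  simp only [coord, wedge, LinearMap.comp_apply, contract_tmul, pairForm_mul_of_lt v _ _ _ hrs hij,
    map_smul, t, coeff_of, AlgHom.toLinearMap_apply]
  by_cases h1 : h = g <;> by_cases h2 : i = r ∧ j = s <;> simp [h1, h2]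

/-- The coefficient of `v_l t_g ⊗ v_l* ∧ v_r* ∧ v_s*`, up to a nonzero factor. -/
def tripleCoord (g : G) (l r s : Fin n) : KoszulCochain q hρ α →ₗ[ℂ] ℂ :=
  (character v hq1 l).toLinearMap ∘ₗ coeff _ α g ∘ₗ contract hρ α (tripleForm v hq0 hq1 hq l r s)

end Coordinates

/-- The span of the cochains `t_g ⊗ v_r* ∧ v_s*`. -/
def constantSpan (q : Fin n → Fin n → ℂ) (hρ : IsDiagonalAction v ρ)
    (α : NormalizedTwoCocycle G) : Submodule ℂ (KoszulCochain q hρ α) :=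
  Submodule.span ℂ {x | ∃ g r s, x = wedge q hρ α (t _ α g) r s}

theorem wedge_mem_constantSpan (g : G) (r s : Fin n) :
    wedge q hρ α (t _ α g) r s ∈ constantSpan q hρ α :=
  Submodule.subset_span ⟨g, r, s, rfl⟩

theorem wedge_self (hq1 : ∀ i, q i i = 1) (b : QuantumSkew q hρ α) (r : Fin n) :
    wedge q hρ α b r r = 0 := by
  rw [wedge, dualGen_mul_self hq1, TensorProduct.tmul_zero]

theorem wedge_swap (b : QuantumSkew q hρ α) (r s : Fin n) :
    wedge q hρ α b r s = (-(q r s)⁻¹) • wedge q hρ α b s r := by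
  rw [wedge, dualGen_mul_dualGen, TensorProduct.tmul_smul, wedge]

theorem smul_wedge (a : ℂ) (b : QuantumSkew q hρ α) (r s : Fin n) :
    wedge q hρ α (a • b) r s = a • wedge q hρ α b r s := TensorProduct.smul_tmul' _ _ _ |>.symm

theorem sum_wedge {ι : Type*} (S : Finset ι) (b : ι → QuantumSkew q hρ α) (r s : Fin n) :
    wedge q hρ α (∑ i ∈ S, b i) r s = ∑ i ∈ S, wedge q hρ α (b i) r s :=
  TensorProduct.sum_tmul ..

theorem constantSpan_eq (hq1 : ∀ i, q i i = 1) : constantSpan q hρ α =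
    Submodule.span ℂ {x | ∃ g r s, r < s ∧ x = wedge q hρ α (t _ α g) r s} := by
  refine le_antisymm (Submodule.span_le.2 ?_) (Submodule.span_mono ?_)
  · rintro _ ⟨g, r, s, rfl⟩
    rcases lt_trichotomy r s with h | rfl | h
    · exact Submodule.subset_span ⟨g, r, s, h, rfl⟩
    · rw [wedge_self hq1]
      exact zero_mem _
    · rw [wedge_swap]
      exact Submodule.smul_mem _ _ (Submodule.subset_span ⟨g, s, r, h, rfl⟩)
  · rintro _ ⟨g, r, s, -, rfl⟩
    exact ⟨g, r, s, rfl⟩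

/-- Linear maps agree on `constantSpan` when they agree on the `t_g ⊗ v_r* ∧ v_s*` with `r < s`. -/
theorem eqOn_constantSpan (hq1 : ∀ i, q i i = 1) {M : Type*} [AddCommGroup M] [Module ℂ M]
    {f f' : KoszulCochain q hρ α →ₗ[ℂ] M}
    (h : ∀ g r s, r < s → f (wedge q hρ α (t _ α g) r s) = f' (wedge q hρ α (t _ α g) r s))
    {x : KoszulCochain q hρ α} (hx : x ∈ constantSpan q hρ α) : f x = f' x := by
  rw [constantSpan_eq hq1] at hx
  refine LinearMap.eqOn_span ?_ hx
  rintro _ ⟨g, r, s, hrs, rfl⟩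
  exact h g r s hrs

theorem eq_sum_coord [Fintype G] (hq0 : ∀ i j, q i j ≠ 0) (hq1 : ∀ i, q i i = 1)
    (hq : ∀ i j, q j i = (q i j)⁻¹) {x : KoszulCochain q hρ α} (hx : x ∈ constantSpan q hρ α) :
    x = ∑ g, ∑ r, ∑ s, if r < s then
      coord hρ α hq0 hq1 hq g r s x • wedge q hρ α (t _ α g) r s else 0 := by
  classical
  have key := eqOn_constantSpan hq1 (f := LinearMap.id)
    (f' := ∑ g, ∑ r, ∑ s, if r < s then
      (coord hρ α hq0 hq1 hq g r s).smulRight (wedge q hρ α (t _ α g) r s) else 0) ?_ hx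
  · refine key.trans ?_
    simp only [LinearMap.sum_apply]
    refine Finset.sum_congr rfl fun g _ => Finset.sum_congr rfl fun r _ =>
      Finset.sum_congr rfl fun s _ => ?_
    split_ifs <;> simp
  · intro h i j hij
    simp only [LinearMap.sum_apply, LinearMap.id_apply]
    rw [Finset.sum_eq_single h, Finset.sum_eq_single i, Finset.sum_eq_single j]
    · simp [hij, coord_wedge]
    · intro s _ hs
      split_ifs with his
      · simp [coord_wedge _ _ _ _ _ his hij, hs.symm]
      · simp
    · simp
    · intro r _ hr
      refine Finset.sum_eq_zero fun s _ => ?_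
      split_ifs with his
      · simp [coord_wedge _ _ _ _ _ his hij, hr.symm]
      · simp
    · simp
    · intro g _ hg
      refine Finset.sum_eq_zero fun r _ => Finset.sum_eq_zero fun s _ => ?_
      split_ifs with his
      · simp [coord_wedge _ _ _ _ _ his hij, hg.symm]
      · simp
    · simp

/-! ### The differential -/

theorem gen_mul (i : Fin n) (b : QuantumSkew q hρ α) (g : G) :
    coeff _ α g (gen q hρ α i * b) = QuantumAlgebra.ι v q (v i) * coeff _ α g b :=
  coeff_of_one_mul _ _ _

theorem quantumAction_ι (g : G) (i : Fin n) :
    quantumAction q hρ g (QuantumAlgebra.ι v q (v i)) =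
      eigenvalue v ρ g i • QuantumAlgebra.ι v q (v i) := by
  refine (quantumActionHom_ι q hρ g (v i)).trans ?_
  rw [hρ.apply_eq, map_smul]

theorem mul_gen (i : Fin n) (b : QuantumSkew q hρ α) (g : G) :
    coeff _ α g (b * gen q hρ α i) =
      eigenvalue v ρ g i • (coeff _ α g b * QuantumAlgebra.ι v q (v i)) := by
  rw [gen, coeff_mul_of_one, quantumAction_ι, mul_smul_comm]

theorem t_mul_gen (g : G) (i : Fin n) :
    t _ α g * gen q hρ α i = eigenvalue v ρ g i • (gen q hρ α i * t _ α g) := by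
  rw [gen, t_mul_of_one', quantumAction_ι, map_smul, smul_mul_assoc]

theorem koszulD_wedge (b : QuantumSkew q hρ α) (r s : Fin n) :
    koszulD q hρ α (wedge q hρ α b r s) =
      ∑ l, (gen q hρ α l * b - ((q r l)⁻¹ * (q s l)⁻¹) • (b * gen q hρ α l)) ⊗ₜ
        (dualGen v q l * (dualGen v q r * dualGen v q s)) := by
  simp only [koszulD, wedge, LinearMap.sum_apply, LinearMap.sub_apply, TensorProduct.map_tmul,
    LinearMap.mulLeft_apply, LinearMap.mulRight_apply, dualGen_mul_mul, TensorProduct.sub_tmul,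
    TensorProduct.tmul_smul, TensorProduct.smul_tmul']

/-- The condition for `t_g ⊗ v_r* ∧ v_s*` to be a Koszul cocycle. -/
def IsAdmissible (v : Module.Basis (Fin n) ℂ V) (ρ : Representation ℂ G V)
    (q : Fin n → Fin n → ℂ) (g : G) (r s : Fin n) : Prop :=
  ∀ l, l ≠ r → l ≠ s → q r l * q s l = eigenvalue v ρ g l

/-- The summands `l ∈ {r, s}` contain a repeated generator. In the others `t_g v_l = λ_{g,l} v_l
t_g`, and admissibility makes the two halves cancel. -/
theorem koszulD_wedge_t (hq0 : ∀ i j, q i j ≠ 0) (hq1 : ∀ i, q i i = 1) {g : G} {r s : Fin n}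
    (h : IsAdmissible v ρ q g r s) : koszulD q hρ α (wedge q hρ α (t _ α g) r s) = 0 := by
  rw [koszulD_wedge]
  refine Finset.sum_eq_zero fun l _ => ?_
  by_cases hr : l = r
  · subst hr
    rw [← mul_assoc, dualGen_mul_self hq1, zero_mul, TensorProduct.tmul_zero]
  by_cases hs : l = s
  · subst hs
    rw [dualGen_mul_dualGen, mul_smul_comm, ← mul_assoc, dualGen_mul_self hq1, zero_mul, smul_zero,
      TensorProduct.tmul_zero]
  have h1 := hq0 r l
  have h2 := hq0 s l
  rw [t_mul_gen, smul_smul, ← h l hr hs]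
  field_simp
  rw [one_smul, sub_self, TensorProduct.zero_tmul]

/-- The same triple wedge can arise from several pairs, but then with different generators in the
first factor. Testing that factor against the character at `l` leaves one scalar equation for each
coordinate of `x`. -/
theorem tripleCoord_koszulD (hq0 : ∀ i j, q i j ≠ 0) (hq1 : ∀ i, q i i = 1)
    (hq : ∀ i j, q j i = (q i j)⁻¹) {x : KoszulCochain q hρ α} (hx : x ∈ constantSpan q hρ α)
    (g : G) {l r s : Fin n} (hrs : r < s) (hr : l ≠ r) (hs : l ≠ s) :
    tripleCoord hρ α hq0 hq1 hq g l r s (koszulD q hρ α x) =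
      (q l r)⁻¹ * (q l s)⁻¹ * (1 - (q r l)⁻¹ * (q s l)⁻¹ * eigenvalue v ρ g l) *
        coord hρ α hq0 hq1 hq g r s x := by
  classical
  refine eqOn_constantSpan hq1 (f := tripleCoord hρ α hq0 hq1 hq g l r s ∘ₗ koszulD q hρ α)
    (f' := ((q l r)⁻¹ * (q l s)⁻¹ * (1 - (q r l)⁻¹ * (q s l)⁻¹ * eigenvalue v ρ g l)) •
      coord hρ α hq0 hq1 hq g r s) (fun h i j hij => ?_) hx
  rw [LinearMap.comp_apply, LinearMap.smul_apply, coord_wedge _ _ _ _ _ hrs hij, koszulD_wedge,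
    map_sum, Finset.sum_eq_single l]
  · simp only [tripleCoord, LinearMap.comp_apply, contract_tmul, tripleForm_mul v _ _ _ hr hs,
      pairForm_mul_of_lt v _ _ _ hrs hij, t_mul_gen, map_smul, map_sub, gen_mul,
      AlgHom.toLinearMap_apply, map_mul, character_ι]
    simp only [t, coeff_of]
    by_cases h1 : h = g <;> by_cases h2 : i = r ∧ j = s <;> simp [h1, h2]
  -- The summand `k` carries the factor `v_k`, which the character at `l` kills.
  · intro k _ hk
    simp only [tripleCoord, LinearMap.comp_apply, contract_tmul, t_mul_gen, map_smul, map_sub,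
      gen_mul, AlgHom.toLinearMap_apply, map_mul, character_ι, hk]
    simp
  · simp

theorem isAdmissible_of_coord_ne_zero (hq0 : ∀ i j, q i j ≠ 0) (hq1 : ∀ i, q i i = 1)
    (hq : ∀ i j, q j i = (q i j)⁻¹) {x : KoszulCochain q hρ α} (hx : x ∈ constantSpan q hρ α)
    (hd : koszulD q hρ α x = 0) {g : G} {r s : Fin n} (hrs : r < s)
    (h : coord hρ α hq0 hq1 hq g r s x ≠ 0) : IsAdmissible v ρ q g r s := by
  intro l hr hs
  have key := tripleCoord_koszulD hq0 hq1 hq hx g hrs hr hs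
  rw [hd, map_zero, eq_comm] at key
  have h1 := hq0 r l
  have h2 := hq0 s l
  have h3 := hq0 l r
  have h4 := hq0 l s
  have h5 : 1 - (q r l)⁻¹ * (q s l)⁻¹ * eigenvalue v ρ g l = 0 := by simpa [h, h3, h4] using key
  field_simp at h5
  rw [mul_zero] at h5
  exact sub_eq_zero.1 h5

/-! ### The group action -/

theorem koszulAct_wedge (h : G) (b : QuantumSkew q hρ α) (r s : Fin n) :
    koszulAct q hρ α h (wedge q hρ α b r s) =
      ((eigenvalue v ρ h r)⁻¹ * (eigenvalue v ρ h s)⁻¹) •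
        wedge q hρ α (conj _ α h b) r s := by
  have key (i : Fin n) : quantumAction (fun i j => -(q i j)⁻¹) hρ.dual h (dualGen v q i) =
      (eigenvalue v ρ h i)⁻¹ • dualGen v q i := by
    refine (quantumActionHom_ι _ hρ.dual h _).trans ?_
    rw [hρ.dual_apply, map_smul]
    rfl
  rw [wedge, koszulAct, TensorProduct.map_tmul, AlgHom.toLinearMap_apply, map_mul, key, key,
    smul_mul_smul_comm, TensorProduct.tmul_smul, wedge]

theorem koszulAct_mul (g h : G) (x : KoszulCochain q hρ α) :
    koszulAct q hρ α (g * h) x = koszulAct q hρ α g (koszulAct q hρ α h x) := by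
  induction x using TensorProduct.induction_on with
  | zero => simp
  | tmul b ω =>
    simp only [koszulAct, TensorProduct.map_tmul, TwistedSkewGroupAlgebra.conj_mul, map_mul]
    rfl
  | add x y hx hy => simp only [map_add, hx, hy]

/-- The scalar by which `h` moves `t_g ⊗ v_r* ∧ v_s*` to `t_{hgh⁻¹} ⊗ v_r* ∧ v_s*`. -/
def actScalar (v : Module.Basis (Fin n) ℂ V) (ρ : Representation ℂ G V)
    (α : NormalizedTwoCocycle G) (h g : G) (r s : Fin n) : ℂ :=
  (α h g : ℂ) / (α (h * g * h⁻¹) h : ℂ) * (eigenvalue v ρ h r)⁻¹ * (eigenvalue v ρ h s)⁻¹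

theorem koszulAct_wedge_t (h g : G) (r s : Fin n) :
    koszulAct q hρ α h (wedge q hρ α (t _ α g) r s) =
      actScalar v ρ α h g r s • wedge q hρ α (t _ α (h * g * h⁻¹)) r s := by
  rw [koszulAct_wedge, conj_t, smul_wedge, smul_smul, actScalar]
  congr 1
  ring

theorem coord_koszulAct (hq0 : ∀ i j, q i j ≠ 0) (hq1 : ∀ i, q i i = 1)
    (hq : ∀ i j, q j i = (q i j)⁻¹) {x : KoszulCochain q hρ α} (hx : x ∈ constantSpan q hρ α)
    (h g : G) {r s : Fin n} (hrs : r < s) :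
    coord hρ α hq0 hq1 hq (h * g * h⁻¹) r s (koszulAct q hρ α h x) =
      actScalar v ρ α h g r s * coord hρ α hq0 hq1 hq g r s x := by
  classical
  refine eqOn_constantSpan hq1
    (f := coord hρ α hq0 hq1 hq (h * g * h⁻¹) r s ∘ₗ koszulAct q hρ α h)
    (f' := actScalar v ρ α h g r s • coord hρ α hq0 hq1 hq g r s) (fun k i j hij => ?_) hx
  rw [LinearMap.comp_apply, LinearMap.smul_apply, coord_wedge _ _ _ _ _ hrs hij, koszulAct_wedge_t,
    map_smul, coord_wedge _ _ _ _ _ hrs hij]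
  by_cases h1 : k = g ∧ i = r ∧ j = s
  · obtain ⟨rfl, rfl, rfl⟩ := h1
    simp
  · rw [if_neg h1, if_neg (by simpa using h1), smul_zero, smul_zero]

theorem mem_constantKoszul {x : KoszulCochain q hρ α} : x ∈ constantKoszul q hρ α ↔
    x ∈ constantSpan q hρ α ∧ koszulD q hρ α x = 0 ∧ ∀ g, koszulAct q hρ α g x = x := by
  simp only [constantKoszul, Submodule.mem_inf, LinearMap.mem_ker, Submodule.mem_iInf,
    LinearMap.sub_apply, LinearMap.id_apply, sub_eq_zero, constantSpan, and_assoc]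

end QuantumSkew


/-! ### Bilinearity of Hochschild cochains -/

namespace TwoCochain

variable {B : Type*} [AddCommGroup B] [Module ℂ B] (μ : TwoCochain B)

/-- A `2`-cochain as a bilinear map. -/
def toBilin : B →ₗ[ℂ] B →ₗ[ℂ] B := μ

theorem eval_eq (a b : B) : μ a b = μ.toBilin a b := rfl

theorem ext_eval {μ ν : TwoCochain B} (h : ∀ a b, μ a b = ν a b) : μ = ν :=
  LinearMap.ext fun a => LinearMap.ext fun b => h a b

end TwoCochain

/-- The alternating sum of the cocycle identities over the orderings of three elements that
commute up to scalars. -/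
theorem hochschildCocycles_skew_identity {B : Type*} [Ring B] [Algebra ℂ B] {μ : TwoCochain B}
    (hμ : μ ∈ hochschildCocycles B) {x y z : B} {p r s : ℂ} (hxy : x * y = p • (y * x))
    (hxz : x * z = r • (z * x)) (hyz : y * z = s • (z * y)) :
    x * (μ y z - s • μ z y) - p • (y * (μ x z - r • μ z x)) +
      (r * s) • (z * (μ x y - p • μ y x)) - (μ x y - p • μ y x) * z +
      s • ((μ x z - r • μ z x) * y) - (p * r) • ((μ y z - s • μ z y) * x) = 0 := by
  have e1 := hμ x y z
  have e2 := hμ x z y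
  have e3 := hμ y x z
  have e4 := hμ y z x
  have e5 := hμ z x y
  have e6 := hμ z y x
  simp only [hxy, hxz, hyz, TwoCochain.eval_eq, map_smul, LinearMap.smul_apply] at e1 e2 e3 e4 e5 e6
  simp only [TwoCochain.eval_eq, mul_sub, sub_mul, mul_smul_comm, smul_mul_assoc]
  -- Each ordering of `x, y, z` is weighted by its sign and by the scalar that turns `x y z` into
  -- it; the terms with a product inside `μ` then cancel in pairs.
  linear_combination (norm := module) e1 - s • e2 - p • e3 + (p * r) • e4 + (r * s) • e5 -
    (p * r * s) • e6

/-! ### Square-zero extensions -/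

/-- The extension of `B` by the square-zero ideal `B` that a Hochschild `2`-cocycle defines:
`(a, m) (b, m') = (a b, a m' + m b + μ(a, b))`. -/
def HochschildExtension {B : Type*} [Ring B] [Algebra ℂ B] (_μ : hochschildCocycles B) : Type _ :=
  B × B

namespace HochschildExtension

variable {B : Type*} [Ring B] [Algebra ℂ B] (μ : hochschildCocycles B)

instance : AddCommGroup (HochschildExtension μ) := inferInstanceAs (AddCommGroup (B × B))

instance : Module ℂ (HochschildExtension μ) := inferInstanceAs (Module ℂ (B × B))

/-- The pair `(a, m)`. -/
def mk (a m : B) : HochschildExtension μ := (a, m)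

/-- The projection to `B`. -/
def fst : HochschildExtension μ →ₗ[ℂ] B := LinearMap.fst ℂ B B

/-- The component in the square-zero ideal. -/
def snd : HochschildExtension μ →ₗ[ℂ] B := LinearMap.snd ℂ B B

variable {μ} in
theorem ext_pair {x y : HochschildExtension μ} (h1 : fst μ x = fst μ y) (h2 : snd μ x = snd μ y) :
    x = y := Prod.ext h1 h2

@[simp]
theorem fst_mk (a m : B) : fst μ (mk μ a m) = a := rfl

@[simp]
theorem snd_mk (a m : B) : snd μ (mk μ a m) = m := rfl

instance : Mul (HochschildExtension μ) :=
  ⟨fun x y => mk μ (fst μ x * fst μ y)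
    (fst μ x * snd μ y + snd μ x * fst μ y + μ.1 (fst μ x) (fst μ y))⟩

/-- Since `μ` need not be normalized, the unit is corrected by `-μ(1, 1)`; the cocycle identity
gives `μ(1, b) = μ(1, 1) b` and `μ(b, 1) = b μ(1, 1)`. -/
instance : One (HochschildExtension μ) := ⟨mk μ 1 (-μ.1 1 1)⟩

@[simp]
theorem fst_mul (x y : HochschildExtension μ) : fst μ (x * y) = fst μ x * fst μ y := rfl

@[simp]
theorem snd_mul (x y : HochschildExtension μ) :
    snd μ (x * y) = fst μ x * snd μ y + snd μ x * fst μ y + μ.1 (fst μ x) (fst μ y) := rfl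

@[simp]
theorem fst_one : fst μ 1 = 1 := rfl

@[simp]
theorem snd_one : snd μ 1 = -μ.1 1 1 := rfl

instance : Ring (HochschildExtension μ) :=
  { (inferInstance : AddCommGroup (HochschildExtension μ)) with
    mul := (· * ·)
    one := 1
    left_distrib := fun x y z => ext_pair (by simp [mul_add])
      (by simp [mul_add, TwoCochain.eval_eq]; abel)
    right_distrib := fun x y z => ext_pair (by simp [add_mul])
      (by simp [add_mul, TwoCochain.eval_eq]; abel)
    zero_mul := fun x => ext_pair (by simp) (by simp [TwoCochain.eval_eq])
    mul_zero := fun x => ext_pair (by simp) (by simp [TwoCochain.eval_eq])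
    one_mul := fun x => ext_pair (by simp) (by
      have h := μ.2 1 1 (fst μ x)
      simp only [one_mul, mul_one] at h
      simp [add_left_cancel h])
    mul_one := fun x => ext_pair (by simp) (by
      have h := μ.2 (fst μ x) 1 1
      simp only [mul_one] at h
      rw [add_comm] at h
      simp [← add_left_cancel h])
    mul_assoc := fun x y z => ext_pair (by simp [mul_assoc]) (by
      have h := μ.2 (fst μ x) (fst μ y) (fst μ z)
      simp only [snd_mul, fst_mul, mul_add, add_mul, mul_assoc]
      linear_combination (norm := abel) -h) }

instance : Algebra ℂ (HochschildExtension μ) :=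
  Algebra.ofModule
    (fun r x y => ext_pair (by simp) (by simp [TwoCochain.eval_eq]))
    (fun r x y => ext_pair (by simp) (by simp [TwoCochain.eval_eq]))

/-- The projection to `B` as an algebra map. -/
def fstHom : HochschildExtension μ →ₐ[ℂ] B :=
  AlgHom.ofLinearMap (fst μ) rfl fun _ _ => rfl

theorem fstHom_apply (x : HochschildExtension μ) : fstHom μ x = fst μ x := rfl

/-- A cocycle is a coboundary when its extension has a multiplicative section. -/
theorem mem_range_hochschildDelta (s : B →ₗ[ℂ] HochschildExtension μ)
    (h1 : ∀ b, fst μ (s b) = b) (hs : ∀ a b, s (a * b) = s a * s b) :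
    μ.1 ∈ LinearMap.range (hochschildDelta B) := by
  -- If `s(b) = (b, f(b))`, multiplicativity says `f(ab) = a f(b) + f(a) b + μ(a, b)`, that is, `μ =
  -- δ(-f)`.
  refine ⟨-(snd μ ∘ₗ s), TwoCochain.ext_eval fun a b => ?_⟩
  have h := congrArg (snd μ) (hs a b)
  rw [snd_mul, h1, h1] at h
  simp only [hochschildDelta_apply, LinearMap.neg_apply, LinearMap.comp_apply, h]
  simp only [mul_neg, neg_mul]
  abel

end HochschildExtension

/-! ### Constant cocycles -/

namespace QuantumSkew

open TwistedSkewGroupAlgebra QuantumAlgebra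

variable {n : ℕ} {G V : Type*} [Group G] [AddCommGroup V] [Module ℂ V]
  {v : Module.Basis (Fin n) ℂ V} {ρ : Representation ℂ G V} {q : Fin n → Fin n → ℂ}
  {hρ : IsDiagonalAction v ρ} {α : NormalizedTwoCocycle G}

theorem mem_degreePart {d : ℕ} {x : QuantumSkew q hρ α} :
    x ∈ degreePart q hρ α d ↔ ∀ g, coeff _ α g x ∈ QuantumAlgebra.degreePart v q d := by
  simp [degreePart, Submodule.mem_iInf]

theorem of_mem_degreePart (g : G) {d : ℕ} {a : QuantumAlgebra v q}
    (ha : a ∈ QuantumAlgebra.degreePart v q d) : of _ α g a ∈ degreePart q hρ α d := by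
  classical
  refine mem_degreePart.2 fun h => ?_
  rw [coeff_of]
  split_ifs
  · exact ha
  · exact zero_mem _

theorem gen_mem_degreePart (i : Fin n) : gen q hρ α i ∈ degreePart q hρ α 1 :=
  of_mem_degreePart 1 (ι_mem_degreePart _)

theorem t_mem_degreePart (g : G) : t _ α g ∈ degreePart q hρ α 0 :=
  of_mem_degreePart g (mem_degreePart_zero.2 ⟨1, one_smul _ _⟩)

theorem coeff_eq_of_mem {b : QuantumSkew q hρ α} (hb : b ∈ degreePart q hρ α 0) (g : G) :
    coeff _ α g b = augmentation v q (coeff _ α g b) • 1 := by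
  obtain ⟨a, ha⟩ := mem_degreePart_zero.1 (mem_degreePart.1 hb g)
  rw [← ha]
  simp

theorem eq_sum_t_of_mem [Fintype G] {b : QuantumSkew q hρ α} (hb : b ∈ degreePart q hρ α 0) :
    b = ∑ g, augmentation v q (coeff _ α g b) • t _ α g := by
  conv_lhs => rw [eq_sum b]
  refine Finset.sum_congr rfl fun g _ => ?_
  rw [t, ← map_smul, ← coeff_eq_of_mem hb]

theorem gen_mul_gen (i j : Fin n) :
    gen q hρ α i * gen q hρ α j = q i j • (gen q hρ α j * gen q hρ α i) := by
  rw [gen, gen, of_one_mul_of, of_one_mul_of, ι_mul_ι, map_smul]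

/-- The quantum skew-symmetrization `μ(v_r, v_s) - q_{rs} μ(v_s, v_r)`. -/
def skewPart (μ : TwoCochain (QuantumSkew q hρ α)) (r s : Fin n) : QuantumSkew q hρ α :=
  μ (gen q hρ α r) (gen q hρ α s) - q r s • μ (gen q hρ α s) (gen q hρ α r)

theorem koszulForm_eq (μ : TwoCochain (QuantumSkew q hρ α)) :
    koszulForm q hρ α μ = ∑ r, ∑ s, if r < s then wedge q hρ α (skewPart μ r s) r s else 0 := rfl

theorem skewPart_self (hq1 : ∀ i, q i i = 1) (μ : TwoCochain (QuantumSkew q hρ α)) (r : Fin n) :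
    skewPart μ r r = 0 := by
  rw [skewPart, hq1, one_smul, sub_self]

theorem skewPart_swap (hq0 : ∀ i j, q i j ≠ 0) (hq : ∀ i j, q j i = (q i j)⁻¹)
    (μ : TwoCochain (QuantumSkew q hρ α)) (r s : Fin n) :
    skewPart μ s r = (-q s r) • skewPart μ r s := by
  have h : q s r * q r s = 1 := by rw [hq r s, inv_mul_cancel₀ (hq0 r s)]
  rw [skewPart, skewPart, smul_sub, smul_smul, neg_mul, h]
  module

/-- The cochain map as a linear map. -/
def koszulFormLinear (q : Fin n → Fin n → ℂ) (hρ : IsDiagonalAction v ρ)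
    (α : NormalizedTwoCocycle G) :
    TwoCochain (QuantumSkew q hρ α) →ₗ[ℂ] KoszulCochain q hρ α where
  toFun := koszulForm q hρ α
  map_add' μ ν := by
    have h (r s : Fin n) : skewPart (μ + ν) r s = skewPart μ r s + skewPart ν r s := by
      simp only [skewPart, TwoCochain.add_eval, smul_add]
      abel
    simp only [koszulForm_eq, ← Finset.sum_add_distrib, h]
    refine Finset.sum_congr rfl fun r _ => Finset.sum_congr rfl fun s _ => ?_
    split_ifs
    · exact TensorProduct.add_tmul _ _ _
    · simp
  map_smul' a μ := by
    have h (r s : Fin n) : skewPart (a • μ) r s = a • skewPart μ r s := by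
      simp only [skewPart, TwoCochain.smul_eval, smul_sub, smul_comm a]
    simp only [koszulForm_eq, Finset.smul_sum, h, smul_wedge, RingHom.id_apply, smul_ite, smul_zero]

theorem contract_koszulForm (hq0 : ∀ i j, q i j ≠ 0) (hq1 : ∀ i, q i i = 1)
    (hq : ∀ i j, q j i = (q i j)⁻¹) (μ : TwoCochain (QuantumSkew q hρ α)) {r s : Fin n}
    (hrs : r < s) :
    contract hρ α (pairForm v hq0 hq1 hq r s) (koszulForm q hρ α μ) = skewPart μ r s := by
  rw [koszulForm_eq]
  simp only [map_sum]
  rw [Finset.sum_eq_single r, Finset.sum_eq_single s]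
  · simp [wedge, hrs, pairForm_mul_of_lt]
  · intro j _ hj
    split_ifs with h
    · simp [wedge, pairForm_mul_of_lt _ _ _ _ hrs h, hj]
    · simp
  · simp
  · intro i _ hi
    refine Finset.sum_eq_zero fun j _ => ?_
    split_ifs with h
    · simp [wedge, pairForm_mul_of_lt _ _ _ _ hrs h, hi]
    · simp
  · simp

theorem skewPart_eq_zero (hq0 : ∀ i j, q i j ≠ 0) (hq1 : ∀ i, q i i = 1)
    (hq : ∀ i j, q j i = (q i j)⁻¹) {μ : TwoCochain (QuantumSkew q hρ α)}
    (h : koszulForm q hρ α μ = 0) (r s : Fin n) : skewPart μ r s = 0 := by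
  rcases lt_trichotomy r s with hrs | rfl | hrs
  · rw [← contract_koszulForm hq0 hq1 hq μ hrs, h, map_zero]
  · exact skewPart_self hq1 μ r
  · rw [skewPart_swap hq0 hq, ← contract_koszulForm hq0 hq1 hq μ hrs, h, map_zero, smul_zero]

end QuantumSkew


namespace QuantumSkew

open TwistedSkewGroupAlgebra QuantumAlgebra

variable {n : ℕ} {G V : Type*} [Group G] [AddCommGroup V] [Module ℂ V]
  {v : Module.Basis (Fin n) ℂ V} {ρ : Representation ℂ G V} {q : Fin n → Fin n → ℂ}
  {hρ : IsDiagonalAction v ρ} {α : NormalizedTwoCocycle G}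

/-! ### Koszul forms of constant cocycles are closed and invariant. -/

section Constant

variable {μ : TwoCochain (QuantumSkew q hρ α)} (hd : μ ∈ bilinOfDegree (degreePart q hρ α) (-2))
include hd

/-- The value lies in a component of negative degree, which is `⊥` by definition, so the membership
unfolds to an equation. -/
theorem eval_t_t (g h : G) : μ (t _ α g) (t _ α h) = 0 :=
  hd 0 0 _ (t_mem_degreePart g) _ (t_mem_degreePart h)

theorem eval_t_gen (g : G) (i : Fin n) : μ (t _ α g) (gen q hρ α i) = 0 :=
  hd 0 1 _ (t_mem_degreePart g) _ (gen_mem_degreePart i)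

theorem eval_gen_t (g : G) (i : Fin n) : μ (gen q hρ α i) (t _ α g) = 0 :=
  hd 1 0 _ (gen_mem_degreePart i) _ (t_mem_degreePart g)

theorem eval_gen_gen_mem (i j : Fin n) :
    μ (gen q hρ α i) (gen q hρ α j) ∈ degreePart q hρ α 0 :=
  hd 1 1 _ (gen_mem_degreePart i) _ (gen_mem_degreePart j)

theorem skewPart_mem (r s : Fin n) : skewPart μ r s ∈ degreePart q hρ α 0 :=
  sub_mem (eval_gen_gen_mem hd r s) (Submodule.smul_mem _ _ (eval_gen_gen_mem hd s r))

theorem koszulForm_mem_constantSpan [Finite G] : koszulForm q hρ α μ ∈ constantSpan q hρ α := by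
  cases nonempty_fintype G
  rw [koszulForm_eq]
  refine sum_mem fun r _ => sum_mem fun s _ => ?_
  split_ifs
  · rw [eq_sum_t_of_mem (skewPart_mem hd r s), sum_wedge]
    refine sum_mem fun g _ => ?_
    rw [smul_wedge]
    exact Submodule.smul_mem _ _ (wedge_mem_constantSpan g r s)
  · exact zero_mem _

variable (hμ : μ ∈ hochschildCocycles (QuantumSkew q hρ α))
include hμ

/-- In the coefficient of `v_l t_g` of the skew identity for `v_l, v_r, v_s`, only the two terms
with the factor `v_l` survive, and `a (1 - q_{lr} q_{ls} λ_{g,l}) = 0` remains, with `a` the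
coefficient of `t_g`. -/
theorem isAdmissible_of_skewPart (hq0 : ∀ i j, q i j ≠ 0) (hq1 : ∀ i, q i i = 1)
    (hq : ∀ i j, q j i = (q i j)⁻¹) {g : G} {r s : Fin n}
    (h : augmentation v q (coeff _ α g (skewPart μ r s)) ≠ 0) : IsAdmissible v ρ q g r s := by
  intro l hr hs
  obtain ⟨a, ha⟩ := mem_degreePart_zero.1 (mem_degreePart.1 (skewPart_mem hd r s) g)
  have h0 : a ≠ 0 := by simpa [← ha] using h
  have key := hochschildCocycles_skew_identity hμ (gen_mul_gen l r) (gen_mul_gen l s)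
    (gen_mul_gen r s)
  have h2 := congrArg (fun b => character v hq1 l (coeff _ α g b)) key
  change character v hq1 l (coeff _ α g (gen q hρ α l * skewPart μ r s -
    q l r • (gen q hρ α r * skewPart μ l s) +
      (q l s * q r s) • (gen q hρ α s * skewPart μ l r) - skewPart μ l r * gen q hρ α s +
      q r s • (skewPart μ l s * gen q hρ α r) -
      (q l r * q l s) • (skewPart μ r s * gen q hρ α l))) = _ at h2
  simp only [map_sub, map_add, map_smul, gen_mul, mul_gen, map_mul, character_ι, if_neg hr.symm,
    if_neg hs.symm, if_true, map_zero, ← ha, map_one] at h2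
  simp only [zero_mul, mul_zero, smul_eq_mul, one_mul, mul_one, sub_zero, add_zero] at h2
  have h3 : 1 - q l r * q l s * eigenvalue v ρ g l = 0 := by
    refine (mul_eq_zero.1 (?_ : _ * a = 0)).resolve_right h0
    linear_combination h2
  rw [hq r l, hq s l] at h3
  have h4 := hq0 r l
  have h5 := hq0 s l
  field_simp at h3
  linear_combination h3

theorem koszulD_koszulForm [Finite G] (hq0 : ∀ i j, q i j ≠ 0) (hq1 : ∀ i, q i i = 1)
    (hq : ∀ i j, q j i = (q i j)⁻¹) : koszulD q hρ α (koszulForm q hρ α μ) = 0 := by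
  cases nonempty_fintype G
  rw [koszulForm_eq]
  simp only [map_sum]
  refine Finset.sum_eq_zero fun r _ => Finset.sum_eq_zero fun s _ => ?_
  split_ifs
  · rw [eq_sum_t_of_mem (skewPart_mem hd r s), sum_wedge, map_sum]
    refine Finset.sum_eq_zero fun g _ => ?_
    rw [smul_wedge, map_smul]
    by_cases h : augmentation v q (coeff _ α g (skewPart μ r s)) = 0
    · rw [h, zero_smul]
    · rw [koszulD_wedge_t hq0 hq1 (isAdmissible_of_skewPart hd hμ hq0 hq1 hq h), smul_zero]
  · exact map_zero _

/-- The cocycle identities at `(t_g, vᵢ, vⱼ)`, `(vᵢ, t_g, vⱼ)` and `(vᵢ, vⱼ, t_g)` carry `t_g` from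
left to right. The values of `μ` at `t_g` and `vᵢ vⱼ` have degree zero and need not vanish. -/
theorem t_mul_eval (g : G) (i j : Fin n) :
    t _ α g * μ (gen q hρ α i) (gen q hρ α j) + μ (t _ α g) (gen q hρ α i * gen q hρ α j) =
      (eigenvalue v ρ g i * eigenvalue v ρ g j) •
        (μ (gen q hρ α i * gen q hρ α j) (t _ α g) +
          μ (gen q hρ α i) (gen q hρ α j) * t _ α g) := by
  have e1 := hμ (t _ α g) (gen q hρ α i) (gen q hρ α j)
  have e2 := hμ (gen q hρ α i) (gen q hρ α j) (t _ α g)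
  have e3 := hμ (gen q hρ α i) (t _ α g) (gen q hρ α j)
  rw [eval_t_gen hd, zero_mul, add_zero, t_mul_gen] at e1
  rw [eval_gen_t hd, mul_zero, zero_add] at e2
  rw [eval_gen_t hd, eval_t_gen hd, mul_zero, zero_mul, zero_add, add_zero, t_mul_gen] at e3
  rw [← e2, e1]
  simp only [TwoCochain.eval_eq, map_smul, LinearMap.smul_apply] at e3 ⊢
  rw [← e3, smul_smul]

/-- Skew-symmetrizing `t_mul_eval` removes the values at `t_g` and `vᵢ vⱼ`, because `v_r v_s =
q_{rs} v_s v_r`. -/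
theorem conj_skewPart (g : G) (r s : Fin n) :
    conj _ α g (skewPart μ r s) =
      (eigenvalue v ρ g r * eigenvalue v ρ g s) • skewPart μ r s := by
  refine conj_eq ?_
  have e1 := t_mul_eval hd hμ g r s
  have e2 := t_mul_eval hd hμ g s r
  rw [gen_mul_gen r s] at e1
  simp only [TwoCochain.eval_eq, map_smul, LinearMap.smul_apply] at e1 e2
  simp only [skewPart, TwoCochain.eval_eq, mul_sub, mul_smul_comm, smul_mul_assoc, sub_mul]
  linear_combination (norm := module) e1 - q r s • e2

theorem koszulAct_koszulForm (g : G) :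
    koszulAct q hρ α g (koszulForm q hρ α μ) = koszulForm q hρ α μ := by
  rw [koszulForm_eq]
  simp only [map_sum]
  refine Finset.sum_congr rfl fun r _ => Finset.sum_congr rfl fun s _ => ?_
  split_ifs
  · have h1 := hρ.eigenvalue_ne_zero g r
    have h2 := hρ.eigenvalue_ne_zero g s
    rw [koszulAct_wedge, conj_skewPart hd hμ, smul_wedge, smul_smul]
    field_simp
    rw [one_smul]
  · exact map_zero _

theorem koszulForm_mem_constantKoszul [Finite G] (hq0 : ∀ i j, q i j ≠ 0) (hq1 : ∀ i, q i i = 1)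
    (hq : ∀ i j, q j i = (q i j)⁻¹) : koszulForm q hρ α μ ∈ constantKoszul q hρ α :=
  mem_constantKoszul.2 ⟨koszulForm_mem_constantSpan hd, koszulD_koszulForm hd hμ hq0 hq1 hq,
    koszulAct_koszulForm hd hμ⟩

end Constant

/-! ### Coboundaries -/

/-- The terms `f(v_r v_s)` and `q_{rs} f(v_s v_r)` cancel, and all others have a generator as a
factor, hence augmentation zero. A skew part has degree zero and is determined by its augmentations,
so `f` itself need not be homogeneous. -/
theorem koszulForm_hochschildDelta (f : QuantumSkew q hρ α →ₗ[ℂ] QuantumSkew q hρ α)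
    (hd : hochschildDelta _ f ∈ bilinOfDegree (degreePart q hρ α) (-2)) :
    koszulForm q hρ α (hochschildDelta _ f) = 0 := by
  rw [koszulForm_eq]
  refine Finset.sum_eq_zero fun r _ => Finset.sum_eq_zero fun s _ => ?_
  have h : skewPart (hochschildDelta _ f) r s = 0 := by
    refine ext_coeff fun g => ?_
    rw [coeff_eq_of_mem (skewPart_mem hd r s), map_zero]
    have : augmentation v q (coeff _ α g (skewPart (hochschildDelta _ f) r s)) = 0 := by
      simp only [skewPart, hochschildDelta_apply, gen_mul_gen r s, map_smul, map_sub, map_add,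
        gen_mul, mul_gen, map_mul, augmentation_ι]
      simp
    rw [this, zero_smul]
  rw [h, wedge, TensorProduct.zero_tmul, ite_self]

/-! ### Constant cocycles with vanishing skew part are coboundaries. -/

section Splitting

variable (μ : hochschildCocycles (QuantumSkew q hρ α))
  (hd : μ.1 ∈ bilinOfDegree (degreePart q hρ α) (-2)) (h0 : ∀ r s, skewPart μ.1 r s = 0)

open HochschildExtension

/-- The lift of `S_q(V)` to the extension defined by a cocycle whose skew-symmetrization
vanishes. -/
def extensionHom : QuantumAlgebra v q →ₐ[ℂ] HochschildExtension μ :=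
  lift v (fun i => mk μ (gen q hρ α i) 0) fun i j => ext_pair
    (by simp [gen_mul_gen i j])
    (by simpa [skewPart, sub_eq_zero] using h0 i j)

theorem extensionHom_ι (i : Fin n) :
    extensionHom μ h0 (QuantumAlgebra.ι v q (v i)) = mk μ (gen q hρ α i) 0 := lift_ι _ _ i

theorem fst_extensionHom (x : QuantumAlgebra v q) :
    fst μ (extensionHom μ h0 x) = of _ α 1 x := by
  induction x using QuantumAlgebra.induction with
  | scalar a =>
    rw [AlgHom.commutes, ← fstHom_apply, AlgHom.commutes, Algebra.algebraMap_eq_smul_one,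
      Algebra.algebraMap_eq_smul_one, map_smul, one_def]
  | gen i => rw [extensionHom_ι, fst_mk, gen]
  | mul x y hx hy => rw [map_mul, fst_mul, hx, hy, of_one_mul_of]
  | add x y hx hy => rw [map_add, map_add, hx, hy, map_add]

include hd in
theorem mk_t_mul_extensionHom (g : G) (x : QuantumAlgebra v q) :
    mk μ (t _ α g) 0 * extensionHom μ h0 x =
      extensionHom μ h0 (quantumAction q hρ g x) * mk μ (t _ α g) 0 := by
  induction x using QuantumAlgebra.induction with
  | scalar a =>
    rw [AlgHom.commutes, AlgHom.commutes, AlgHom.commutes]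
    exact (Algebra.commutes _ _).symm
  | gen i =>
    rw [quantumAction_ι, map_smul, extensionHom_ι]
    refine ext_pair ?_ ?_
    · simp [t_mul_gen]
    · simp [eval_t_gen hd, eval_gen_t hd]
  | mul x y hx hy => rw [map_mul, map_mul, map_mul, ← mul_assoc, hx, mul_assoc, hy, mul_assoc]
  | add x y hx hy => rw [map_add, map_add, map_add, mul_add, add_mul, hx, hy]

include hd in
theorem mk_t_mul_mk_t (g h : G) :
    mk μ (t _ α g) 0 * mk μ (t _ α h) 0 = (α g h : ℂ) • mk μ (t _ α (g * h)) 0 :=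
  ext_pair (by simp [t_mul_t]) (by simp [eval_t_t hd])

/-- The section `a t_g ↦ s(a) (t_g, 0)`. -/
def extensionSection [Fintype G] : QuantumSkew q hρ α →ₗ[ℂ] HochschildExtension μ :=
  ∑ g, LinearMap.mulRight ℂ (mk μ (t _ α g) 0) ∘ₗ (extensionHom μ h0).toLinearMap ∘ₗ coeff _ α g

theorem extensionSection_of [Fintype G] (g : G) (a : QuantumAlgebra v q) :
    extensionSection μ h0 (of _ α g a) = extensionHom μ h0 a * mk μ (t _ α g) 0 := by
  classical
  simp only [extensionSection, LinearMap.sum_apply, LinearMap.comp_apply, coeff_of,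
    LinearMap.mulRight_apply, AlgHom.toLinearMap_apply]
  rw [Finset.sum_eq_single g]
  · rw [if_pos rfl]
  · intro h _ hh
    rw [if_neg hh.symm, map_zero, zero_mul]
  · simp

-- The lift of `S_q(V)` and the elements `(t_g, 0)` obey the commutation and twisting rules of the
-- skew group algebra, so together they form a multiplicative section of the extension.
include hd h0 in
theorem mem_range_hochschildDelta_of_skewPart [Finite G] :
    μ.1 ∈ LinearMap.range (hochschildDelta (QuantumSkew q hρ α)) := by
  cases nonempty_fintype G
  refine mem_range_hochschildDelta μ (extensionSection μ h0) (fun b => ?_) fun a b => ?_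
  · have : fst μ ∘ₗ extensionSection μ h0 = LinearMap.id := hom_ext fun g a => by
      rw [LinearMap.comp_apply, extensionSection_of, fst_mul, fst_extensionHom, fst_mk,
        of_one_mul_t, LinearMap.id_apply]
    exact LinearMap.congr_fun this b
  · have : (LinearMap.mul ℂ (QuantumSkew q hρ α)).compr₂ (extensionSection μ h0) =
        (LinearMap.mul ℂ (HochschildExtension μ)).compl₁₂ (extensionSection μ h0)
          (extensionSection μ h0) := hom_ext fun g a => hom_ext fun h b => by
      simp only [LinearMap.compr₂_apply, LinearMap.compl₁₂_apply, LinearMap.mul_apply',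
        of_mul_of, extensionSection_of, map_smul, map_mul]
      symm
      rw [mul_assoc, ← mul_assoc (mk μ (t _ α g) 0), mk_t_mul_extensionHom μ hd, mul_assoc,
        mk_t_mul_mk_t μ hd, mul_smul_comm, mul_smul_comm, mul_assoc]
    exact LinearMap.congr_fun₂ this a b

end Splitting

end QuantumSkew


/-! ### Cocycles of a skew group algebra from equivariant cocycles of the base -/

namespace TwistedSkewGroupAlgebra

variable {G A : Type*} [Group G] [Ring A] [Algebra ℂ A] {φ : G →* (A →ₐ[ℂ] A)}
  {α : NormalizedTwoCocycle G}

theorem induction_of {P : TwistedSkewGroupAlgebra φ α → Prop} (of_mem : ∀ g a, P (of φ α g a))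
    (add : ∀ x y, P x → P y → P (x + y)) (x : TwistedSkewGroupAlgebra φ α) : P x :=
  Finsupp.induction_linear x (map_zero (of φ α 1) ▸ of_mem 1 0) add of_mem

/-- The Hochschild `2`-cocycles of `A` with values in the bimodule `A #_α G`. -/
def IsBaseCocycle (ν : A →ₗ[ℂ] A →ₗ[ℂ] TwistedSkewGroupAlgebra φ α) : Prop :=
  ∀ x y z, of φ α 1 x * ν y z + ν x (y * z) = ν (x * y) z + ν x y * of φ α 1 z

/-- The average of the translates of a bilinear map under `G`. -/
def average [Fintype G] (ν : A →ₗ[ℂ] A →ₗ[ℂ] TwistedSkewGroupAlgebra φ α) :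
    A →ₗ[ℂ] A →ₗ[ℂ] TwistedSkewGroupAlgebra φ α :=
  (Fintype.card G : ℂ)⁻¹ • ∑ k, (ν.compl₁₂ (φ k⁻¹).toLinearMap (φ k⁻¹).toLinearMap).compr₂
    (conj φ α k)

theorem average_apply [Fintype G] (ν : A →ₗ[ℂ] A →ₗ[ℂ] TwistedSkewGroupAlgebra φ α) (x y : A) :
    average ν x y = (Fintype.card G : ℂ)⁻¹ • ∑ k, conj φ α k (ν (φ k⁻¹ x) (φ k⁻¹ y)) := by
  simp [average, LinearMap.sum_apply]

/-- Conjugation by `t_k` is multiplicative and restricts to `φ k` on `A`, so every translate of a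
cocycle is a cocycle. -/
theorem IsBaseCocycle.average [Fintype G] {ν : A →ₗ[ℂ] A →ₗ[ℂ] TwistedSkewGroupAlgebra φ α}
    (hν : IsBaseCocycle ν) : IsBaseCocycle (average ν) := by
  intro x y z
  simp only [average_apply, mul_smul_comm, smul_mul_assoc, ← smul_add, Finset.mul_sum,
    Finset.sum_mul, ← Finset.sum_add_distrib]
  congr 1
  refine Finset.sum_congr rfl fun k _ => ?_
  have h := congrArg (conj φ α k) (hν (φ k⁻¹ x) (φ k⁻¹ y) (φ k⁻¹ z))
  have h2 (a : A) : φ k (φ k⁻¹ a) = a := by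
    rw [← AlgHom.mul_apply, ← map_mul, mul_inv_cancel, map_one, AlgHom.one_apply]
  simpa only [map_add, conj_mul_apply, conj_of_one, h2, ← map_mul (φ k⁻¹)] using h

theorem conj_average [Fintype G] (ν : A →ₗ[ℂ] A →ₗ[ℂ] TwistedSkewGroupAlgebra φ α) (g : G)
    (x y : A) : conj φ α g (average ν x y) = average ν (φ g x) (φ g y) := by
  simp only [average_apply, map_smul, map_sum]
  congr 1
  refine Fintype.sum_equiv (Equiv.mulLeft g) _ _ fun k => ?_
  rw [← TwistedSkewGroupAlgebra.conj_mul, Equiv.coe_mulLeft]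
  have h (a : A) : φ (g * k)⁻¹ (φ g a) = φ k⁻¹ a := by
    rw [← AlgHom.mul_apply, ← map_mul, mul_inv_rev, inv_mul_cancel_right]
  rw [h, h]

/-- The extension `(x t_g, y t_h) ↦ ν(x, ᵍy) t_g t_h`. -/
def extend [Fintype G] (ν : A →ₗ[ℂ] A →ₗ[ℂ] TwistedSkewGroupAlgebra φ α) :
    TwoCochain (TwistedSkewGroupAlgebra φ α) :=
  show TwistedSkewGroupAlgebra φ α →ₗ[ℂ] TwistedSkewGroupAlgebra φ α →ₗ[ℂ]
      TwistedSkewGroupAlgebra φ α from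
  ∑ g, ∑ h, (ν.compl₁₂ (coeff φ α g) ((φ g).toLinearMap ∘ₗ coeff φ α h)).compr₂
    (LinearMap.mulRight ℂ (t φ α g * t φ α h))

theorem extend_eval [Fintype G] (ν : A →ₗ[ℂ] A →ₗ[ℂ] TwistedSkewGroupAlgebra φ α)
    (x y : TwistedSkewGroupAlgebra φ α) :
    extend ν x y =
      ∑ g, ∑ h, ν (coeff φ α g x) (φ g (coeff φ α h y)) * (t φ α g * t φ α h) := by
  rw [TwoCochain.eval_eq, TwoCochain.toBilin, extend]
  simp only [LinearMap.sum_apply]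
  rfl

theorem extend_of_of [Fintype G] (ν : A →ₗ[ℂ] A →ₗ[ℂ] TwistedSkewGroupAlgebra φ α)
    (g h : G) (x y : A) :
    extend ν (of φ α g x) (of φ α h y) = ν x (φ g y) * (t φ α g * t φ α h) := by
  classical
  rw [extend_eval, Finset.sum_eq_single g, Finset.sum_eq_single h]
  · simp [coeff_of]
  · intro k _ hk
    simp [coeff_of, hk.symm]
  · simp
  · intro k _ hk
    simp [coeff_of, hk.symm]
  · simp

/-- On `x t_g, y t_h, z t_k`, moving the group elements to the right turns the identity into that of
`ν` at `x, ᵍy, ᵍʰz`, multiplied by `t_g t_h t_k`. Equivariance serves only in `e1`, where `t_g`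
passes a value of `ν`. -/
theorem extend_mem_hochschildCocycles [Fintype G]
    {ν : A →ₗ[ℂ] A →ₗ[ℂ] TwistedSkewGroupAlgebra φ α} (hν : IsBaseCocycle ν)
    (he : ∀ g x y, conj φ α g (ν x y) = ν (φ g x) (φ g y)) :
    extend ν ∈ hochschildCocycles (TwistedSkewGroupAlgebra φ α) := by
  intro a b c
  induction a using induction_of with
  | add a a' h h' =>
    simp only [TwoCochain.eval_eq, add_mul, map_add, LinearMap.add_apply] at h h' ⊢
    linear_combination (norm := abel) h + h'
  | of_mem g x =>
    induction b using induction_of with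
    | add b b' h h' =>
      simp only [TwoCochain.eval_eq, add_mul, mul_add, map_add, LinearMap.add_apply] at h h' ⊢
      linear_combination (norm := abel) h + h'
    | of_mem h y =>
      induction c using induction_of with
      | add c c' h h' =>
        simp only [TwoCochain.eval_eq, mul_add, map_add] at h h' ⊢
        linear_combination (norm := abel) h + h'
      | of_mem k z =>
        have e1 : of φ α g x * extend ν (of φ α h y) (of φ α k z) =
            of φ α 1 x * ν (φ g y) (φ g (φ h z)) * (t φ α g * t φ α h * t φ α k) := by
          rw [extend_of_of, ← of_one_mul_t g x, ← he]
          simp only [← mul_assoc]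
          rw [mul_assoc _ (conj φ α g _), conj_mul_t, ← mul_assoc]
        have e2 : extend ν (of φ α g x) (of φ α h y * of φ α k z) =
            ν x (φ g y * φ g (φ h z)) * (t φ α g * t φ α h * t φ α k) := by
          rw [of_mul_of, map_smul, TwoCochain.eval_eq, map_smul, ← TwoCochain.eval_eq,
            extend_of_of, map_mul, mul_assoc (t φ α g), t_mul_t h k, mul_smul_comm, mul_smul_comm]
        have e3 : extend ν (of φ α g x * of φ α h y) (of φ α k z) =
            ν (x * φ g y) (φ g (φ h z)) * (t φ α g * t φ α h * t φ α k) := by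
          rw [of_mul_of, map_smul, TwoCochain.eval_eq, map_smul, LinearMap.smul_apply,
            ← TwoCochain.eval_eq, extend_of_of, t_mul_t g h, smul_mul_assoc, mul_smul_comm,
            map_mul φ, AlgHom.mul_apply]
        have e4 : extend ν (of φ α g x) (of φ α h y) * of φ α k z =
            ν x (φ g y) * of φ α 1 (φ g (φ h z)) * (t φ α g * t φ α h * t φ α k) := by
          rw [extend_of_of, ← of_one_mul_t k z]
          simp only [mul_assoc]
          rw [← mul_assoc (t φ α h) (of φ α 1 z), t_mul_of_one', mul_assoc,
            ← mul_assoc (t φ α g) (of φ α 1 _), t_mul_of_one', mul_assoc]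
        rw [e1, e2, e3, e4, ← add_mul, ← add_mul, hν]

end TwistedSkewGroupAlgebra

theorem mem_extendDegree_of_le {B : Type*} [AddCommGroup B] [Module ℂ B] {F : ℕ → Submodule ℂ B}
    (f : B →ₗ[ℂ] B) (hf : ∀ d, ∀ x ∈ F d, f x ∈ F d) (k : ℤ) {x : B}
    (hx : x ∈ extendDegree F k) : f x ∈ extendDegree F k := by
  cases k with
  | ofNat d => exact hf d x hx
  | negSucc d =>
    have hx' : x = 0 := hx
    rw [hx', map_zero]
    exact zero_mem _

/-! ### Averaging and extension preserve the degree. -/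

namespace QuantumSkew

open TwistedSkewGroupAlgebra QuantumAlgebra

variable {n : ℕ} {G V : Type*} [Group G] [AddCommGroup V] [Module ℂ V]
  {v : Module.Basis (Fin n) ℂ V} {ρ : Representation ℂ G V} {q : Fin n → Fin n → ℂ}
  {hρ : IsDiagonalAction v ρ} {α : NormalizedTwoCocycle G}

theorem quantumAction_mem_degreePart (g : G) {d : ℕ} {x : QuantumAlgebra v q}
    (hx : x ∈ QuantumAlgebra.degreePart v q d) :
    quantumAction q hρ g x ∈ QuantumAlgebra.degreePart v q d :=
  map_degreePart_le _ (fun i => by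
    rw [quantumAction_ι]; exact Submodule.smul_mem _ _ ⟨_, rfl⟩) hx

theorem mul_t_mem_degreePart [Finite G] (h : G) {d : ℕ} {x : QuantumSkew q hρ α}
    (hx : x ∈ degreePart q hρ α d) : x * t _ α h ∈ degreePart q hρ α d := by
  cases nonempty_fintype G
  rw [eq_sum x, Finset.sum_mul]
  refine sum_mem fun g _ => ?_
  rw [t, of_mul_of, map_one, mul_one]
  exact of_mem_degreePart _ (Submodule.smul_mem _ _ (mem_degreePart.1 hx g))

theorem conj_mem_degreePart [Finite G] (k : G) {d : ℕ} {x : QuantumSkew q hρ α}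
    (hx : x ∈ degreePart q hρ α d) : conj _ α k x ∈ degreePart q hρ α d := by
  cases nonempty_fintype G
  rw [eq_sum x, map_sum]
  refine sum_mem fun g _ => ?_
  rw [← of_one_mul_t, conj_mul_apply, conj_of_one, conj_t, mul_smul_comm, of_one_mul_t]
  exact Submodule.smul_mem _ _
    (of_mem_degreePart _ (quantumAction_mem_degreePart k (mem_degreePart.1 hx g)))

/-- Bilinear maps of degree `-2` on `S_q(V)`. -/
def IsConstantBilin (ν : QuantumAlgebra v q →ₗ[ℂ] QuantumAlgebra v q →ₗ[ℂ] QuantumSkew q hρ α) :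
    Prop :=
  ∀ i j : ℕ, ∀ x ∈ QuantumAlgebra.degreePart v q i, ∀ y ∈ QuantumAlgebra.degreePart v q j,
    ν x y ∈ extendDegree (degreePart q hρ α) (i + j + (-2))

theorem IsConstantBilin.average [Fintype G]
    {ν : QuantumAlgebra v q →ₗ[ℂ] QuantumAlgebra v q →ₗ[ℂ] QuantumSkew q hρ α}
    (hν : IsConstantBilin ν) : IsConstantBilin (average ν) := by
  intro i j x hx y hy
  rw [average_apply]
  refine Submodule.smul_mem _ _ (sum_mem fun k _ => ?_)
  exact mem_extendDegree_of_le _ (fun d x hx => conj_mem_degreePart k hx) _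
    (hν i j _ (quantumAction_mem_degreePart _ hx) _ (quantumAction_mem_degreePart _ hy))

theorem IsConstantBilin.extend [Fintype G]
    {ν : QuantumAlgebra v q →ₗ[ℂ] QuantumAlgebra v q →ₗ[ℂ] QuantumSkew q hρ α}
    (hν : IsConstantBilin ν) : extend ν ∈ bilinOfDegree (degreePart q hρ α) (-2) := by
  intro i j x hx y hy
  rw [extend_eval]
  refine sum_mem fun g _ => sum_mem fun h _ => ?_
  refine mem_extendDegree_of_le (LinearMap.mulRight ℂ (t _ α g * t _ α h)) (fun d x hx => ?_) _
    (hν i j _ (mem_degreePart.1 hx g) _ (quantumAction_mem_degreePart g (mem_degreePart.1 hy h)))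
  rw [LinearMap.mulRight_apply, ← mul_assoc]
  exact mul_t_mem_degreePart h (mul_t_mem_degreePart g hx)

/-! ### The cocycles attached to admissible triples -/

section Cup

variable (hq0 : ∀ i j, q i j ≠ 0) (hq1 : ∀ i, q i i = 1) (hq : ∀ i j, q j i = (q i j)⁻¹)

/-- The twist `vⱼ ↦ q_{rj} vⱼ` for `j ≠ r`, `v_r ↦ λ_{a,r} q_{sr}⁻¹ v_r`. -/
def cupTwist (v : Module.Basis (Fin n) ℂ V) (ρ : Representation ℂ G V) (q : Fin n → Fin n → ℂ)
    (a : G) (r s : Fin n) (j : Fin n) : ℂ :=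
  -- As `q r r = 1`, the value at `r` is free. It is chosen so that, with the factor `q s r` of the
  -- opposite twist, `v_r` is scaled by `λ_{a,r}`.
  if j = r then eigenvalue v ρ a r * (q s r)⁻¹ else q r j

include hq0 hq1 hq in
theorem isSkewTwist_cupTwist (a : G) (r s : Fin n) :
    IsSkewTwist q r (cupTwist v ρ q a r s) where
  twist_eq j hj := by simp [cupTwist, hj]
  mul_eq_one j _ := by rw [hq r j, inv_mul_cancel₀ (hq0 r j)]
  diag := by rw [hq1, one_mul]

-- At `r` and `s` this holds by the choice of the twists; at every other index it is admissibility.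
include hq0 in
theorem scale_cupTwist {a : G} {r s : Fin n} (hrs : r ≠ s) (h : IsAdmissible v ρ q a r s)
    (x : QuantumAlgebra v q) :
    scale v q (cupTwist v ρ q a r s) (scale v q (cupTwist v ρ q a s r) x) =
      quantumAction q hρ a x := by
  refine AlgHom.congr_fun (φ₁ := (scale v q (cupTwist v ρ q a r s)).comp
    (scale v q (cupTwist v ρ q a s r))) (hom_ext_basis fun i => ?_) x
  rw [AlgHom.comp_apply, scale_ι, map_smul, scale_ι, smul_smul, quantumAction_ι]
  refine congrArg (· • _) ?_
  by_cases hr : i = r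
  · subst hr
    have := hq0 s i
    simp only [cupTwist, if_neg hrs, if_true]
    field_simp
  · by_cases hs : i = s
    · subst hs
      have := hq0 r i
      simp only [cupTwist, if_neg hr, if_true]
      field_simp
    · rw [cupTwist, cupTwist, if_neg hr, if_neg hs, ← h i hr hs, mul_comm]

/-- The cup product `(x, y) ↦ ∂_r(x) σ(∂_s(y)) t_a` of two skew derivations. -/
def cupCochain (hρ : IsDiagonalAction v ρ) (α : NormalizedTwoCocycle G) (a : G) (r s : Fin n) :
    QuantumAlgebra v q →ₗ[ℂ] QuantumAlgebra v q →ₗ[ℂ] QuantumSkew q hρ α :=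
  ((LinearMap.mul ℂ (QuantumAlgebra v q)).compl₁₂
    (skewDer v (isSkewTwist_cupTwist (v := v) (ρ := ρ) hq0 hq1 hq a r s))
    ((scale v q (cupTwist v ρ q a r s)).toLinearMap ∘ₗ
      skewDer v (isSkewTwist_cupTwist (v := v) (ρ := ρ) hq0 hq1 hq a s r))).compr₂ (of _ α a)

theorem cupCochain_apply (a : G) (r s : Fin n) (x y : QuantumAlgebra v q) :
    cupCochain hq0 hq1 hq hρ α a r s x y = of _ α a
      (skewDer v (isSkewTwist_cupTwist (v := v) (ρ := ρ) hq0 hq1 hq a r s) x *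
        scale v q (cupTwist v ρ q a r s)
          (skewDer v (isSkewTwist_cupTwist (v := v) (ρ := ρ) hq0 hq1 hq a s r) y)) := rfl

/-- By the skew Leibniz rules both sides agree up to the factor at the end of `∂_r(x) σ(∂_s(y))`:
the composed twists of `z` on the left, `ᵃz` on the right. These are equal by `scale_cupTwist`. -/
theorem isBaseCocycle_cupCochain {a : G} {r s : Fin n} (hrs : r ≠ s)
    (h : IsAdmissible v ρ q a r s) : IsBaseCocycle (cupCochain hq0 hq1 hq hρ α a r s) := by
  intro x y z
  simp only [cupCochain_apply, of_one_mul_of, of_mul_of_one, ← map_add]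
  congr 1
  simp only [skewDer_mul, map_add, map_mul, scale_cupTwist hq0 hrs h (hρ := hρ)]
  noncomm_ring

theorem isConstantBilin_cupCochain (a : G) (r s : Fin n) :
    IsConstantBilin (cupCochain hq0 hq1 hq hρ α a r s) := by
  intro i j x hx y hy
  rw [cupCochain_apply]
  cases i with
  | zero => rw [skewDer_eq_zero _ hx, zero_mul, map_zero]; exact zero_mem _
  | succ i =>
    cases j with
    | zero => rw [skewDer_eq_zero _ hy, map_zero, mul_zero, map_zero]; exact zero_mem _
    | succ j =>
      have : ((i + 1 : ℕ) : ℤ) + ((j + 1 : ℕ) : ℤ) + (-2) = ((i + j : ℕ) : ℤ) := by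
        push_cast; ring
      rw [this]
      exact of_mem_degreePart a (mul_mem_degreePart (skewDer_mem_degreePart _ hx)
        (scale_mem_degreePart _ (skewDer_mem_degreePart _ hy)))

theorem cupCochain_ι (a : G) (r s i j : Fin n) :
    cupCochain hq0 hq1 hq hρ α a r s (QuantumAlgebra.ι v q (v i)) (QuantumAlgebra.ι v q (v j)) =
      if i = r ∧ j = s then t _ α a else 0 := by
  rw [cupCochain_apply, skewDer_ι, skewDer_ι]
  by_cases h1 : i = r <;> by_cases h2 : j = s <;> simp [h1, h2, t]

theorem average_cupCochain_ι [Fintype G] (a : G) (r s i j : Fin n) :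
    average (cupCochain hq0 hq1 hq hρ α a r s) (QuantumAlgebra.ι v q (v i))
        (QuantumAlgebra.ι v q (v j)) =
      if i = r ∧ j = s then (Fintype.card G : ℂ)⁻¹ • ∑ k,
        ((eigenvalue v ρ k r)⁻¹ * (eigenvalue v ρ k s)⁻¹) • conj _ α k (t _ α a) else 0 := by
  simp only [average_apply, quantumAction_ι, map_smul, LinearMap.smul_apply, cupCochain_ι]
  split_ifs with h
  · obtain ⟨rfl, rfl⟩ := h
    simp only [hρ.eigenvalue_inv, smul_smul, mul_comm]
  · simp

/-- The Hochschild cocycle whose Koszul form is the average of the translates of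
`t_a ⊗ v_r* ∧ v_s*`. -/
def cupCocycle [Fintype G] (hρ : IsDiagonalAction v ρ) (α : NormalizedTwoCocycle G) (a : G)
    (r s : Fin n) : TwoCochain (QuantumSkew q hρ α) :=
  extend (average (cupCochain hq0 hq1 hq hρ α a r s))

/-- Among pairs of generators the averaged cochain can be nonzero only at `(v_r, v_s)`, so for
increasing indices the exchanged term of the skew part is zero. -/
theorem koszulForm_cupCocycle [Fintype G] (a : G) {r s : Fin n} (hrs : r < s) :
    koszulForm q hρ α (cupCocycle hq0 hq1 hq hρ α a r s) =
      (Fintype.card G : ℂ)⁻¹ • ∑ k, koszulAct q hρ α k (wedge q hρ α (t _ α a) r s) := by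
  have key (i j : Fin n) (hij : i < j) : skewPart (cupCocycle hq0 hq1 hq hρ α a r s) i j =
      if i = r ∧ j = s then (Fintype.card G : ℂ)⁻¹ • ∑ k,
        ((eigenvalue v ρ k r)⁻¹ * (eigenvalue v ρ k s)⁻¹) • conj _ α k (t _ α a) else 0 := by
    have h : ¬(j = r ∧ i = s) := by rintro ⟨rfl, rfl⟩; exact lt_asymm hrs hij
    simp only [skewPart, cupCocycle, gen, extend_of_of, map_one, AlgHom.one_apply, t_one, mul_one,
      average_cupCochain_ι, if_neg h, smul_zero, sub_zero]
  rw [koszulForm_eq, Finset.sum_eq_single r, Finset.sum_eq_single s]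
  · rw [if_pos hrs, key r s hrs, if_pos ⟨rfl, rfl⟩, smul_wedge, sum_wedge]
    simp only [koszulAct_wedge, smul_wedge]
  · intro j _ hj
    split_ifs with h
    · rw [key r j h, if_neg (by simp [hj]), wedge, TensorProduct.zero_tmul]
    · rfl
  · simp
  · intro i _ hi
    refine Finset.sum_eq_zero fun j _ => ?_
    split_ifs with h
    · rw [key i j h, if_neg (by simp [hi]), wedge, TensorProduct.zero_tmul]
    · rfl
  · simp

include hq0 hq1 hq in
/-- Every element of `constantKoszul` is the Koszul form of a constant cocycle. -/
theorem exists_koszulForm_eq [Finite G] {x : KoszulCochain q hρ α}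
    (hx : x ∈ constantKoszul q hρ α) :
    ∃ μ ∈ hochschildCocycles (QuantumSkew q hρ α), μ ∈ bilinOfDegree (degreePart q hρ α) (-2) ∧
      koszulForm q hρ α μ = x := by
  cases nonempty_fintype G
  obtain ⟨h1, h2, h3⟩ := mem_constantKoszul.1 hx
  suffices h : x ∈ (hochschildCocycles (QuantumSkew q hρ α) ⊓
      bilinOfDegree (degreePart q hρ α) (-2)).map (koszulFormLinear q hρ α) by
    obtain ⟨μ, ⟨h4, h5⟩, h6⟩ := h
    exact ⟨μ, h4, h5, h6⟩
  -- An invariant form is its own average, so each term may be treated separately although it is not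
  -- invariant itself.
  have hx : x = ((Fintype.card G : ℂ)⁻¹ • ∑ k, koszulAct q hρ α k) x := by
    rw [LinearMap.smul_apply, LinearMap.sum_apply, Finset.sum_congr rfl fun k _ => h3 k,
      Finset.sum_const, Finset.card_univ, ← Nat.cast_smul_eq_nsmul ℂ, smul_smul,
      inv_mul_cancel₀ (Nat.cast_ne_zero.2 Fintype.card_ne_zero), one_smul]
  rw [hx, eq_sum_coord hq0 hq1 hq h1]
  simp only [map_sum]
  refine sum_mem fun a _ => sum_mem fun r _ => sum_mem fun s _ => ?_
  split_ifs with hrs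
  · rw [map_smul]
    by_cases hc : coord hρ α hq0 hq1 hq a r s x = 0
    · rw [hc, zero_smul]
      exact zero_mem _
    · have ha := isAdmissible_of_coord_ne_zero hq0 hq1 hq h1 h2 hrs hc
      refine Submodule.smul_mem _ _ ⟨cupCocycle hq0 hq1 hq hρ α a r s, ⟨?_, ?_⟩, ?_⟩
      · exact extend_mem_hochschildCocycles (isBaseCocycle_cupCochain hq0 hq1 hq hrs.ne ha).average
          (conj_average _)
      · exact (isConstantBilin_cupCochain hq0 hq1 hq a r s).average.extend
      · refine (koszulForm_cupCocycle hq0 hq1 hq a hrs).trans ?_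
        rw [LinearMap.smul_apply, LinearMap.sum_apply]
  · rw [map_zero]
    exact zero_mem _

end Cup

end QuantumSkew


/-- Two surjections with the same kernel have isomorphic targets. -/
theorem LinearMap.exists_equiv_of_ker_eq {M N P : Type*} [AddCommGroup M] [Module ℂ M]
    [AddCommGroup N] [Module ℂ N] [AddCommGroup P] [Module ℂ P] (f : M →ₗ[ℂ] N) (g : M →ₗ[ℂ] P)
    (hf : Function.Surjective f) (hg : Function.Surjective g)
    (h : LinearMap.ker f = LinearMap.ker g) : ∃ e : N ≃ₗ[ℂ] P, ∀ x, e (f x) = g x := by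
  refine ⟨(f.quotKerEquivOfSurjective hf).symm ≪≫ₗ Submodule.quotEquivOfEq _ _ h ≪≫ₗ
    g.quotKerEquivOfSurjective hg, fun x => ?_⟩
  simp

namespace QuantumSkew

open TwistedSkewGroupAlgebra QuantumAlgebra

variable {n : ℕ} {G V : Type*} [Group G] [AddCommGroup V] [Module ℂ V]
  {v : Module.Basis (Fin n) ℂ V} {ρ : Representation ℂ G V} {q : Fin n → Fin n → ℂ}
  {hρ : IsDiagonalAction v ρ} {α : NormalizedTwoCocycle G} {R : Set G}

/-! ### The basis of orbit sums -/

theorem basisElement_eq (T : Finset G) (a : G) (r s : Fin n) :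
    basisElement q hρ α T a r s = ∑ g ∈ T, koszulAct q hρ α g (wedge q hρ α (t _ α a) r s) := by
  simp only [koszulAct_wedge_t]
  rfl

theorem conj_eq_of_mem_centralizer {a h : G} (hh : h ∈ Subgroup.centralizer {a}) :
    h * a * h⁻¹ = a :=
  mul_inv_eq_of_eq_mul (Subgroup.mem_centralizer_singleton_iff.1 hh)

theorem mem_centralizer_of_conj_eq {a h : G} (hh : h * a * h⁻¹ = a) :
    h ∈ Subgroup.centralizer {a} :=
  Subgroup.mem_centralizer_singleton_iff.2 (mul_inv_eq_iff_eq_mul.1 hh)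

/-- Identifies the eigenvalue condition of `Index` as the condition that the centralizer of `a`
fixes `t_a ⊗ v_r* ∧ v_s*`. -/
theorem actScalar_eq_one_iff (hρ : IsDiagonalAction v ρ) {a h : G}
    (hh : h ∈ Subgroup.centralizer {a}) (r s : Fin n) : actScalar v ρ α h a r s = 1 ↔
      eigenvalue v ρ h r * eigenvalue v ρ h s = (α h a : ℂ) / (α a h : ℂ) := by
  have h1 := hρ.eigenvalue_ne_zero h r
  have h2 := hρ.eigenvalue_ne_zero h s
  rw [actScalar, conj_eq_of_mem_centralizer hh]
  field_simp
  exact eq_comm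

theorem koszulAct_wedge_of_mem_centralizer {p : G × Fin n × Fin n} (hp : p ∈ Index v ρ q α R)
    {h : G} (hh : h ∈ Subgroup.centralizer {p.1}) :
    koszulAct q hρ α h (wedge q hρ α (t _ α p.1) p.2.1 p.2.2) =
      wedge q hρ α (t _ α p.1) p.2.1 p.2.2 := by
  rw [koszulAct_wedge_t, (actScalar_eq_one_iff hρ hh _ _).2 (hp.2.2.2 h hh), one_smul,
    conj_eq_of_mem_centralizer hh]

/-- Each group element is uniquely a product of an element of `T` and one of the centralizer, and
the latter acts trivially. The sum over all of `G` makes invariance evident. -/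
theorem card_smul_basisElement [Fintype G] {p : G × Fin n × Fin n} (hp : p ∈ Index v ρ q α R)
    {T : Finset G}
    (hT : Subgroup.IsComplement (T : Set G) (Subgroup.centralizer {p.1} : Set G)) :
    (Nat.card (Subgroup.centralizer {p.1}) : ℂ) • basisElement q hρ α T p.1 p.2.1 p.2.2 =
      ∑ g, koszulAct q hρ α g (wedge q hρ α (t _ α p.1) p.2.1 p.2.2) := by
  classical
  have e := Fintype.sum_equiv (Equiv.ofBijective _ hT)
    (fun x : ↥(T : Set G) × ↥(Subgroup.centralizer {p.1} : Set G) =>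
      koszulAct q hρ α x.1 (wedge q hρ α (t _ α p.1) p.2.1 p.2.2))
    (fun g => koszulAct q hρ α g (wedge q hρ α (t _ α p.1) p.2.1 p.2.2)) fun x => by
      change _ = koszulAct q hρ α (x.1 * x.2) _
      rw [koszulAct_mul, koszulAct_wedge_of_mem_centralizer hp x.2.2]
  rw [← e, Fintype.sum_prod_type, basisElement_eq, Finset.smul_sum, ← Finset.sum_coe_sort T]
  refine Finset.sum_congr rfl fun g _ => ?_
  change _ = ∑ _c : ↥(Subgroup.centralizer {p.1} : Set G), koszulAct q hρ α g _
  rw [Finset.sum_const, Finset.card_univ, ← Nat.cast_smul_eq_nsmul ℂ, Fintype.card_eq_nat_card]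
  rfl

theorem basisElement_mem [Finite G] (hq0 : ∀ i j, q i j ≠ 0) (hq1 : ∀ i, q i i = 1)
    {p : G × Fin n × Fin n} (hp : p ∈ Index v ρ q α R) {T : Finset G}
    (hT : Subgroup.IsComplement (T : Set G) (Subgroup.centralizer {p.1} : Set G)) :
    basisElement q hρ α T p.1 p.2.1 p.2.2 ∈ constantKoszul q hρ α := by
  cases nonempty_fintype G
  have hc : (Nat.card (Subgroup.centralizer {p.1}) : ℂ) ≠ 0 := Nat.cast_ne_zero.2 Nat.card_pos.ne'
  refine mem_constantKoszul.2 ⟨sum_mem fun g _ => Submodule.smul_mem _ _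
    (wedge_mem_constantSpan _ _ _), ?_, fun h => ?_⟩
  · rw [basisElement_eq, map_sum]
    refine Finset.sum_eq_zero fun g _ => ?_
    rw [koszulAct_wedge_t, map_smul, koszulD_wedge_t hq0 hq1, smul_zero]
    intro l hr hs
    -- For a diagonal action `λ_{gag⁻¹,l} = λ_{a,l}`, so admissibility passes to conjugates.
    rw [hρ.eigenvalue_mul, hρ.eigenvalue_mul, hρ.eigenvalue_inv, mul_right_comm,
      mul_inv_cancel₀ (hρ.eigenvalue_ne_zero g l), one_mul]
    exact hp.2.2.1 l hr hs
  -- After multiplication by the order of the centralizer, invariance is a reindexing of the sum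
  -- over `G`.
  · refine smul_right_injective _ hc ?_
    change _ • koszulAct q hρ α h _ = _ • _
    rw [← map_smul, card_smul_basisElement hp hT, map_sum]
    refine Fintype.sum_equiv (Equiv.mulLeft h) _ _ fun g => ?_
    rw [Equiv.coe_mulLeft, koszulAct_mul]

theorem coord_basisElement (hq0 : ∀ i j, q i j ≠ 0) (hq1 : ∀ i, q i i = 1)
    (hq : ∀ i j, q j i = (q i j)⁻¹) (hR : ∀ x : G, ∃! a, a ∈ R ∧ IsConj a x)
    {p p' : G × Fin n × Fin n} (hp : p ∈ Index v ρ q α R) (hp' : p' ∈ Index v ρ q α R)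
    {T : Finset G}
    (hT : Subgroup.IsComplement (T : Set G) (Subgroup.centralizer {p.1} : Set G)) [Decidable (p = p')] :
    coord hρ α hq0 hq1 hq p'.1 p'.2.1 p'.2.2 (basisElement q hρ α T p.1 p.2.1 p.2.2) =
      if p = p' then 1 else 0 := by
  classical
  simp only [basisElement_eq, koszulAct_wedge_t, map_sum, map_smul,
    coord_wedge hρ α hq0 hq1 hq hp'.2.1 hp.2.1]
  split_ifs with hpp
  · subst hpp
    -- The transversal `T` need not contain `1`; its representative `g` of the trivial coset lies in
    -- the centralizer and hence acts with scalar `1`.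
    obtain ⟨⟨⟨g, hg⟩, ⟨c, hc⟩⟩, hgc⟩ := hT.2 1
    have hgc : g * c = 1 := hgc
    have hg' : g ∈ Subgroup.centralizer {p.1} := by
      rw [eq_inv_of_mul_eq_one_left hgc]
      exact inv_mem hc
    rw [Finset.sum_eq_single g]
    · rw [(actScalar_eq_one_iff hρ hg' _ _).2 (hp.2.2.2 g hg'),
        if_pos ⟨conj_eq_of_mem_centralizer hg', rfl, rfl⟩, one_smul]
    · intro k hk hkg
      rw [if_neg, smul_zero]
      rintro ⟨h, -⟩
      have hk' := mem_centralizer_of_conj_eq h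
      -- A second element of `T` in the centralizer would give another factorization of `1`.
      have := @hT.1 (⟨k, hk⟩, ⟨k⁻¹, inv_mem hk'⟩) (⟨g, hg⟩, ⟨g⁻¹, inv_mem hg'⟩) (by simp)
      exact hkg (congrArg (fun x => x.1.1) this)
    · intro h
      exact absurd hg h
  · refine Finset.sum_eq_zero fun g _ => ?_
    rw [if_neg, smul_zero]
    rintro ⟨h1, h2, h3⟩
    refine hpp (Prod.ext ?_ (Prod.ext h2 h3))
    exact (hR p'.1).unique ⟨hp.1, isConj_iff.2 ⟨g, h1⟩⟩ ⟨hp'.1, IsConj.refl _⟩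

/-- The coordinates at the triples of the index set. -/
def indexCoord (hρ : IsDiagonalAction v ρ) (α : NormalizedTwoCocycle G) (hq0 : ∀ i j, q i j ≠ 0)
    (hq1 : ∀ i, q i i = 1) (hq : ∀ i j, q j i = (q i j)⁻¹) (R : Set G) :
    constantKoszul q hρ α →ₗ[ℂ] Index v ρ q α R → ℂ :=
  LinearMap.pi fun p =>
    coord hρ α hq0 hq1 hq p.1.1 p.1.2.1 p.1.2.2 ∘ₗ (constantKoszul q hρ α).subtype

/-- Invariance carries a zero coordinate at a representative to its whole conjugacy class. A nonzero
one would satisfy `Index`: closedness gives admissibility, and invariance under the centralizer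
gives the eigenvalue condition. -/
theorem indexCoord_injective [Finite G] (hq0 : ∀ i j, q i j ≠ 0) (hq1 : ∀ i, q i i = 1)
    (hq : ∀ i j, q j i = (q i j)⁻¹) (hR : ∀ x : G, ∃! a, a ∈ R ∧ IsConj a x) :
    Function.Injective (indexCoord hρ α hq0 hq1 hq R) := by
  cases nonempty_fintype G
  rw [injective_iff_map_eq_zero]
  rintro ⟨x, hx⟩ h0
  obtain ⟨h1, h2, h3⟩ := mem_constantKoszul.1 hx
  have key (h g : G) (r s : Fin n) (hrs : r < s) : coord hρ α hq0 hq1 hq (h * g * h⁻¹) r s x =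
      actScalar v ρ α h g r s * coord hρ α hq0 hq1 hq g r s x := by
    rw [← coord_koszulAct hq0 hq1 hq h1 h g hrs, h3]
  refine Subtype.ext ((eq_sum_coord hq0 hq1 hq h1).trans ?_)
  refine Finset.sum_eq_zero fun g _ => Finset.sum_eq_zero fun r _ => Finset.sum_eq_zero fun s _ => ?_
  split_ifs with hrs
  · obtain ⟨a, ⟨ha, hag⟩, -⟩ := hR g
    obtain ⟨h, rfl⟩ := isConj_iff.1 hag
    suffices hc : coord hρ α hq0 hq1 hq a r s x = 0 by
      rw [key h a r s hrs, hc, mul_zero, zero_smul]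
    by_contra hc
    have hi : (a, r, s) ∈ Index v ρ q α R := by
      refine ⟨ha, hrs, isAdmissible_of_coord_ne_zero hq0 hq1 hq h1 h2 hrs hc, fun c hcent => ?_⟩
      refine (actScalar_eq_one_iff hρ hcent r s).1 ?_
      have h4 := key c a r s hrs
      rw [conj_eq_of_mem_centralizer hcent] at h4
      exact (mul_eq_right₀ hc).1 h4.symm
    exact hc (congrFun h0 ⟨(a, r, s), hi⟩)
  · rfl

/-- The orbit sums form a basis. -/
theorem exists_basis_constantKoszul [Finite G] (hq0 : ∀ i j, q i j ≠ 0) (hq1 : ∀ i, q i i = 1)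
    (hq : ∀ i j, q j i = (q i j)⁻¹) (hR : ∀ x : G, ∃! a, a ∈ R ∧ IsConj a x) (T : G → Finset G)
    (hT : ∀ a ∈ R, Subgroup.IsComplement (T a : Set G) (Subgroup.centralizer {a} : Set G)) :
    ∃ b : Module.Basis (Index v ρ q α R) ℂ (constantKoszul q hρ α), ∀ p,
      (b p : KoszulCochain q hρ α) =
        basisElement q hρ α (T p.1.1) p.1.1 p.1.2.1 p.1.2.2 := by
  classical
  have hE (p : Index v ρ q α R) : indexCoord hρ α hq0 hq1 hq R
      ⟨_, basisElement_mem hq0 hq1 p.2 (hT p.1.1 p.2.1)⟩ = Pi.single p 1 := by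
    funext p'
    refine (coord_basisElement hq0 hq1 hq hR p.2 p'.2 (hT p.1.1 p.2.1)).trans ?_
    simp only [Pi.single_apply, ← Subtype.ext_iff, eq_comm]
  have hsurj : Function.Surjective (indexCoord hρ α hq0 hq1 hq R) := by
    cases nonempty_fintype (Index v ρ q α R)
    intro f
    refine ⟨∑ p, f p • ⟨_, basisElement_mem hq0 hq1 p.2 (hT p.1.1 p.2.1)⟩, ?_⟩
    simp only [map_sum, map_smul, hE]
    exact (pi_eq_sum_univ' f).symm
  have hbij : Function.Bijective (indexCoord hρ α hq0 hq1 hq R) :=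
    ⟨indexCoord_injective hq0 hq1 hq hR, hsurj⟩
  refine ⟨Module.Basis.ofEquivFun (LinearEquiv.ofBijective _ hbij), fun p => ?_⟩
  rw [Module.Basis.coe_ofEquivFun]
  refine congrArg Subtype.val ((LinearEquiv.symm_apply_eq _).2 (hE p).symm :
    (LinearEquiv.ofBijective _ hbij).symm (Pi.single p 1) = _)

/-! ### The isomorphism -/

/-- The Koszul form on constant cocycles. -/
def constantKoszulForm [Finite G] (hρ : IsDiagonalAction v ρ) (α : NormalizedTwoCocycle G)
    (hq0 : ∀ i j, q i j ≠ 0) (hq1 : ∀ i, q i i = 1) (hq : ∀ i j, q j i = (q i j)⁻¹) :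
    constantCocycles (degreePart q hρ α) →ₗ[ℂ] constantKoszul q hρ α :=
  (koszulFormLinear q hρ α ∘ₗ (hochschildCocycles _).subtype ∘ₗ
    (constantCocycles _).subtype).codRestrict _
      fun μ => koszulForm_mem_constantKoszul μ.2 μ.1.2 hq0 hq1 hq

theorem constantKoszulForm_surjective [Finite G] (hq0 : ∀ i j, q i j ≠ 0)
    (hq1 : ∀ i, q i i = 1) (hq : ∀ i j, q j i = (q i j)⁻¹) :
    Function.Surjective (constantKoszulForm hρ α hq0 hq1 hq) := by
  rintro ⟨x, hx⟩
  obtain ⟨μ, h1, h2, rfl⟩ := exists_koszulForm_eq hq0 hq1 hq hx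
  exact ⟨⟨⟨μ, h1⟩, h2⟩, rfl⟩

/-- Both kernels consist of the constant cocycles that are coboundaries: one inclusion is
`koszulForm_hochschildDelta`, the other is the splitting of the extension. -/
theorem ker_constantKoszulForm [Finite G] (hq0 : ∀ i j, q i j ≠ 0) (hq1 : ∀ i, q i i = 1)
    (hq : ∀ i j, q j i = (q i j)⁻¹) :
    LinearMap.ker ((Submodule.mkQ ((LinearMap.range (hochschildDelta
      (QuantumSkew q hρ α))).submoduleOf (hochschildCocycles _))).submoduleMap
        (constantCocycles (degreePart q hρ α))) =
      LinearMap.ker (constantKoszulForm hρ α hq0 hq1 hq) := by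
  ext ⟨μ, hμ⟩
  have hl : (Submodule.mkQ ((LinearMap.range (hochschildDelta
      (QuantumSkew q hρ α))).submoduleOf (hochschildCocycles _))).submoduleMap
        (constantCocycles (degreePart q hρ α)) ⟨μ, hμ⟩ = 0 ↔
      μ.1 ∈ LinearMap.range (hochschildDelta (QuantumSkew q hρ α)) :=
    Subtype.ext_iff.trans (Submodule.Quotient.mk_eq_zero _)
  have hr : constantKoszulForm hρ α hq0 hq1 hq ⟨μ, hμ⟩ = 0 ↔ koszulForm q hρ α μ.1 = 0 :=
    Subtype.ext_iff
  rw [LinearMap.mem_ker, LinearMap.mem_ker, hl, hr]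
  constructor
  · rintro ⟨f, hf⟩
    have hd : μ.1 ∈ bilinOfDegree (degreePart q hρ α) (-2) := hμ
    rw [← hf] at hd ⊢
    exact koszulForm_hochschildDelta f hd
  · intro h
    exact mem_range_hochschildDelta_of_skewPart μ hμ (skewPart_eq_zero hq0 hq1 hq h)

/-- Constant Hochschild classes are the same as constant Koszul cocycles. -/
theorem exists_constantHH2_equiv [Finite G] (hρ : IsDiagonalAction v ρ)
    (α : NormalizedTwoCocycle G) (hq0 : ∀ i j, q i j ≠ 0) (hq1 : ∀ i, q i i = 1)
    (hq : ∀ i j, q j i = (q i j)⁻¹) :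
    ∃ Φ : constantHH2 (degreePart q hρ α) ≃ₗ[ℂ] constantKoszul q hρ α,
      ∀ (μ : hochschildCocycles (QuantumSkew q hρ α))
        (hμ : μ ∈ constantCocycles (degreePart q hρ α)),
        (Φ (constantClass (degreePart q hρ α) μ hμ) : KoszulCochain q hρ α) =
          koszulForm q hρ α μ.1 := by
  obtain ⟨Φ, hΦ⟩ := LinearMap.exists_equiv_of_ker_eq _ _
    (LinearMap.submoduleMap_surjective _ _)
    (constantKoszulForm_surjective (hρ := hρ) (α := α) hq0 hq1 hq)
    (ker_constantKoszulForm hq0 hq1 hq)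
  exact ⟨Φ, fun μ hμ => congrArg Subtype.val (hΦ ⟨μ, hμ⟩)⟩

end QuantumSkew

end

theorem mainTheorem9 {n : ℕ} {G V : Type*} [Group G] [Finite G] [AddCommGroup V] [Module ℂ V]
    (v : Module.Basis (Fin n) ℂ V) (ρ : Representation ℂ G V) (hρ : IsDiagonalAction v ρ)
    (q : Fin n → Fin n → ℂ) (hq0 : ∀ i j, q i j ≠ 0) (hq1 : ∀ i, q i i = 1)
    (hq : ∀ i j, q j i = (q i j)⁻¹) (α : NormalizedTwoCocycle G)
    (R : Set G) (hR : ∀ x : G, ∃! a, a ∈ R ∧ IsConj a x)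
    (T : G → Finset G)
    (hT : ∀ a ∈ R, Subgroup.IsComplement (T a : Set G) (Subgroup.centralizer {a} : Set G)) :
    ∃ Φ : constantHH2 (QuantumSkew.degreePart q hρ α) ≃ₗ[ℂ] QuantumSkew.constantKoszul q hρ α,
      (∀ (μ : hochschildCocycles (QuantumSkew q hρ α))
          (hμ : μ ∈ constantCocycles (QuantumSkew.degreePart q hρ α)),
        (Φ (constantClass (QuantumSkew.degreePart q hρ α) μ hμ) : QuantumSkew.KoszulCochain q hρ α) =
          QuantumSkew.koszulForm q hρ α μ.1) ∧
      ∃ b : Module.Basis (QuantumSkew.Index v ρ q α R) ℂ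
          (constantHH2 (QuantumSkew.degreePart q hρ α)),
        ∀ p : QuantumSkew.Index v ρ q α R,
          (Φ (b p) : QuantumSkew.KoszulCochain q hρ α) =
            QuantumSkew.basisElement q hρ α (T p.1.1) p.1.1 p.1.2.1 p.1.2.2 := by
  obtain ⟨Φ, hΦ⟩ := QuantumSkew.exists_constantHH2_equiv hρ α hq0 hq1 hq
  obtain ⟨b, hb⟩ := QuantumSkew.exists_basis_constantKoszul (hρ := hρ) (α := α) hq0 hq1 hq hR T hT
  refine ⟨Φ, hΦ, b.map Φ.symm, fun p => ?_⟩
  rw [Module.Basis.map_apply, LinearEquiv.apply_symm_apply]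
  exact hb p
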